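/- Fix $T>0$. **Series.** Let $\mathcal A$ be the complex algebra of formal series $f=\sum_{k\ge 0}\sum_{i_1,\dots,i_k\ge 1}c_{i_1,\dots,i_k}X_{i_1}\cdots X_{i_k}\,t^{i_1+\cdots+i_k}$ in noncommuting variables $X_1,X_2,\dots$, with the weakest topology making all coefficients continuous, and let $G\subset\mathcal A$ be the group of series with constant term $1$, with the induced topology. For $f\in\mathcal A$ with zero constant term put $\exp(f)=\sum_{n\ge0}f^n/n!\in G$. **Formal paths.** Let $X$ be the set of sequences $a=(a_1,a_2,\dots)$ of bounded measurable functions $a_i:[0,T]\to\mathbb C$ with $\sup_{x,i}|a_i(x)|^{1/i}<\infty$, and $X^2=\{a\in X: a_i=0 \text{ for } i>2\}$. For $a\in X$ let $E(a)=F(T)\in G$, where $F$ is the solution of $F'(x)=\big(\sum_{i\ge1}a_i(x)t^iX_i\big)F(x)$, $F(0)=1$, obtained by Picard iteration; that is, the coefficient of $X_{i_k}\cdots X_{i_1}$ in $E(a)$ is $$I_{i_1,\dots,i_k}(a)=\int\cdots\int_{0\le s_1\le\cdots\le s_k\le T}a_{i_k}(s_k)\cdots a_{i_1}(s_1)\,ds_k\cdots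 ds_1 .$$ The group of formal paths $G_f(X)$ and the group of formal paths $G_f(X^2)$ in $\mathbb C^2$ are the closures in $G$ of $E(X)$ and of $E(X^2)$. For $g\in G$ let $\widehat I_{i_1,\dots,i_k}(g)$ be the coefficient of $X_{i_k}\cdots X_{i_1}$ in $g$. **First return map.** Let $G[[r]]$ be the set of formal complex power series $r+\sum_{i\ge1}d_ir^{i+1}$, with the weakest topology making all $d_i$ continuous. With $p_{i_1,\dots,i_k}(z)=\prod_{j=1}^k(z-i_1-\cdots-i_j+1)$ put $$\widehat P(g)=r+\sum_{i\ge1}\Big(\sum_{i_1+\cdots+i_k=i}p_{i_1,\dots,i_k}(i)\,\widehat I_{i_1,\dots,i_k}(g)\Big)r^{i+1}.$$ Let $\widehat P_2$ be the restriction of $\widehat P$ to $G_f(X^2)$, let $\widehat{\mathcal C}_f=\{g\in G_f(X):\widehat P(g)=r\}$, and let $\widehat{\mathcal C}^{\,2}_f=\widehat{\mathcal C}_f\cap G_f(X^2)$ be the group of formal centers of Abel differential equations. **Commutators.** For $n\ge 2$ put $r_n=\frac{(-1)^n}{(n-2)!}[X_1,[X_1,[\cdots,[X_1,X_2]\cdots]]]$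 with $n-2$ brackets. For $k\ge 2$ put $\gamma_{i_1,\dots,i_k}=(i_{k-1}-i_k)(i_{k-2}-i_{k-1}-i_k)\cdots(i_1-i_2-\cdots-i_k)$. For $i_1,\dots,i_k\in\{1,2\}$ with $n=i_1+\cdots+i_k\ge5$ put $$l_{i_1,\dots,i_k}=[X_{i_1},[X_{i_2},[\cdots,[X_{i_{k-1}},X_{i_k}]\cdots]]]-\gamma_{i_1,\dots,i_k}\,r_n .$$ **Proposition 3.12.** (1) There is a continuous map $T^2_f:G[[r]]\to G_f(X^2)$ such that $\widehat P_2\circ T^2_f=\mathrm{id}$ and the map $(s,g)\mapsto T^2_f(s)\cdot g$ is a homeomorphism from $G[[r]]\times\widehat{\mathcal C}^{\,2}_f$ onto $G_f(X^2)$. (2) $\widehat{\mathcal C}^{\,2}_f$ is the closure, in $G_f(X^2)$, of the group generated by all elements $\exp(c\,l_{i_1,\dots,i_k}t^{n})$ with $c\in\mathbb C$, $i_1,\dots,i_k\in\{1,2\}$ and $n=i_1+\cdots+i_k\ge 5$. -/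

import Mathlib

open scoped PowerSeries

namespace CenterProblem

noncomputable section

/-- The algebra of formal series
`c₀ I + ∑_{n ≥ 1} (∑_{i₁ + ⋯ + i_k = n} c_{i₁, …, i_k} X_{i₁} ⋯ X_{i_k}) t ^ n`
in noncommuting variables `X₁, X₂, …`. The power of `t` attached to a monomial is determined by the
monomial, so a series is the same as its family of coefficients, indexed by the words
`[i₁, …, i_k]`, the empty word being the index of `c₀`. -/
def Series : Type := List ℕ+ → ℂ

namespace Series

instance : AddCommGroup Series := inferInstanceAs (AddCommGroup (List ℕ+ → ℂ))

instance : Module ℂ Series := inferInstanceAs (Module ℂ (List ℕ+ → ℂ))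

/-- The weakest topology in which all coefficients are continuous. -/
instance : TopologicalSpace Series := inferInstanceAs (TopologicalSpace (List ℕ+ → ℂ))

/-- The Cauchy product: the coefficient of a word is the sum over all its factorizations. -/
instance : Mul Series :=
  ⟨fun f g w => ∑ j ∈ Finset.range (w.length + 1), f (w.take j) * g (w.drop j)⟩

instance : One Series := ⟨fun w => if w = [] then 1 else 0⟩

theorem mul_apply (f g : Series) (w : List ℕ+) :
    (f * g) w = ∑ j ∈ Finset.range (w.length + 1), f (w.take j) * g (w.drop j) := rfl

theorem add_apply (f g : Series) (w : List ℕ+) : (f + g) w = f w + g w := rfl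

theorem sub_apply (f g : Series) (w : List ℕ+) : (f - g) w = f w - g w := rfl

theorem zero_apply (w : List ℕ+) : (0 : Series) w = 0 := rfl

theorem one_nil : (1 : Series) [] = 1 := rfl

theorem one_cons (i : ℕ+) (w : List ℕ+) : (1 : Series) (i :: w) = 0 := rfl

/-- The series whose coefficient at a word `v` is the coefficient of `f` at the word `i :: v`. -/
def shift (f : Series) (i : ℕ+) : Series := fun v => f (i :: v)

theorem mul_nil (f g : Series) : (f * g) [] = f [] * g [] := by
  simp [mul_apply]

theorem mul_cons (f g : Series) (i : ℕ+) (w : List ℕ+) :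
    (f * g) (i :: w) = f [] * g (i :: w) + (f.shift i * g) w := by
  simp only [mul_apply, List.length_cons]
  rw [Finset.sum_range_succ']
  simp [add_comm, shift]

theorem zero_mul_apply (g : Series) (w : List ℕ+) : ((0 : Series) * g) w = 0 := by
  simp [mul_apply, zero_apply]

theorem one_mul_apply (g : Series) (w : List ℕ+) : ((1 : Series) * g) w = g w := by
  cases w with
  | nil => simp [mul_nil, one_nil]
  | cons i w =>
    rw [mul_cons, one_nil, one_mul]
    have h : (1 : Series).shift i = 0 := rfl
    rw [h, zero_mul_apply, add_zero]

theorem mul_one_apply (w : List ℕ+) : ∀ f : Series, (f * (1 : Series)) w = f w := by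
  induction w with
  | nil => intro f; simp [mul_nil, one_nil]
  | cons i w ih => intro f; rw [mul_cons, one_cons, mul_zero, zero_add, ih]; rfl

theorem mul_assoc_apply (h : Series) (w : List ℕ+) :
    ∀ f g : Series, ((f * g) * h) w = (f * (g * h)) w := by
  induction w with
  | nil => intro f g; simp [mul_nil, mul_assoc]
  | cons i w ih =>
    intro f g
    have e : (f * g).shift i
        = f [] • g.shift i + f.shift i * g := by
      funext v
      exact mul_cons f g i v
    have e2 : ∀ (c : ℂ) (a b : Series), ((c • a + b) * h) w = c * (a * h) w + (b * h) w := by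
      intro c a b
      simp only [mul_apply, Finset.mul_sum, ← Finset.sum_add_distrib]
      refine Finset.sum_congr rfl fun j _ => ?_
      have : (c • a + b) (w.take j) = c * a (w.take j) + b (w.take j) := rfl
      rw [this]; ring
    rw [mul_cons, e, e2, ih, mul_cons f, mul_cons g, mul_nil]
    ring

instance : Ring Series where
  __ := (inferInstance : AddCommGroup Series)
  mul := (· * ·)
  one := 1
  mul_assoc f g h := funext fun w => mul_assoc_apply h w f g
  one_mul f := funext fun w => one_mul_apply f w
  mul_one f := funext fun w => mul_one_apply w f
  left_distrib f g h := funext fun w => by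
    simp only [mul_apply, add_apply, mul_add, Finset.sum_add_distrib]
  right_distrib f g h := funext fun w => by
    simp only [mul_apply, add_apply, add_mul, Finset.sum_add_distrib]
  zero_mul f := funext fun w => zero_mul_apply f w
  mul_zero f := funext fun w => by simp [mul_apply, zero_apply]

theorem pow_apply_eq_zero (h : Series) (h0 : h [] = 0) (n : ℕ) :
    ∀ w : List ℕ+, w.length < n → (h ^ n) w = 0 := by
  induction n with
  | zero => intro w hw; omega
  | succ n ih =>
    intro w hw
    rw [pow_succ', mul_apply]
    refine Finset.sum_eq_zero fun j _ => ?_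
    rcases Nat.eq_zero_or_pos j with rfl | hj
    · simp [h0]
    · by_cases hw0 : w.length = 0
      · have : w = [] := List.length_eq_zero_iff.mp hw0
        subst this
        simp [h0]
      · rw [ih (w.drop j) (by rw [List.length_drop]; omega), mul_zero]

/-- The inverse `∑ₙ (I - f) ^ n` of a series `f` with constant term `1`. In the coefficient of a
word `w` only the terms with `n ≤ length w` contribute. -/
def geomInv (f : Series) : Series :=
  fun w => ∑ n ∈ Finset.range (w.length + 1), ((1 - f) ^ n) w

theorem mul_geomInv (f : Series) (hf : f [] = 1) : f * geomInv f = 1 := by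
  have h0 : (1 - f : Series) [] = 0 := by rw [sub_apply, one_nil, hf, sub_self]
  have hsum : ∀ (s : Finset ℕ) (F : ℕ → Series) (v : List ℕ+),
      (∑ n ∈ s, F n) v = ∑ n ∈ s, F n v := fun s F v => Finset.sum_apply v s F
  funext w
  have hg : ∀ v : List ℕ+, v.length ≤ w.length →
      geomInv f v = (∑ n ∈ Finset.range (w.length + 1), (1 - f) ^ n) v := by
    intro v hv
    rw [hsum]
    refine Finset.sum_subset (fun n hn => ?_) (fun n _ hn => ?_)
    · simp only [Finset.mem_range] at hn ⊢; omega
    · simp only [Finset.mem_range] at hn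
      exact pow_apply_eq_zero _ h0 n v (by omega)
  have h1 : (f * geomInv f) w
      = (f * ∑ n ∈ Finset.range (w.length + 1), (1 - f) ^ n) w := by
    simp only [mul_apply]
    refine Finset.sum_congr rfl fun j _ => ?_
    rw [hg _ (by rw [List.length_drop]; omega)]
  have h2 : f * ∑ n ∈ Finset.range (w.length + 1), (1 - f) ^ n
      = 1 - (1 - f) ^ (w.length + 1) := by
    have := mul_neg_geom_sum (1 - f) (w.length + 1)
    rwa [sub_sub_cancel] at this
  rw [h1, h2, sub_apply, pow_apply_eq_zero _ h0 _ w (Nat.lt_succ_self _), sub_zero]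

/-- The element `X_i t ^ i`. -/
def X (i : ℕ+) : Series := fun w => if w = [i] then 1 else 0

end Series

/-- The group `G` of series with constant term `1`, with the topology induced from `Series`. -/
def SeriesGroup : Type := {f : Series // f [] = 1}

namespace SeriesGroup

instance : TopologicalSpace SeriesGroup :=
  inferInstanceAs (TopologicalSpace {f : Series // f [] = 1})

instance : Mul SeriesGroup :=
  ⟨fun f g => ⟨f.1 * g.1, by rw [Series.mul_nil, f.2, g.2, one_mul]⟩⟩

instance : One SeriesGroup := ⟨⟨1, rfl⟩⟩

instance : Inv SeriesGroup :=
  ⟨fun f => ⟨Series.geomInv f.1, by simp [Series.geomInv, Series.one_nil]⟩⟩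

instance : Group SeriesGroup :=
  Group.ofRightAxioms
    (fun f g h => Subtype.ext (mul_assoc f.1 g.1 h.1))
    (fun f => Subtype.ext (mul_one f.1))
    (fun f => Subtype.ext (Series.mul_geomInv f.1 f.2))

/-- The exponential `e ^ f = ∑ₙ f ^ n / n!` of a series `f` with zero constant term. In the
coefficient of a word `w` only the terms with `n ≤ length w` contribute. -/
def exp (f : Series) : SeriesGroup :=
  ⟨fun w => ∑ n ∈ Finset.range (w.length + 1), (f ^ n) w / (n.factorial : ℂ),
    by simp [Series.one_nil]⟩

/-- The basic iterated integral `I_{i₁, …, i_k}`, as a function on the group: the coefficient of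
`X_{i_k} ⋯ X_{i₁}`. -/
def iteratedIntegral (g : SeriesGroup) (w : List ℕ+) : ℂ := g.1 w.reverse

end SeriesGroup

/-- The space of coefficients of the equations `v' = ∑ a_i(x) v ^ (i + 1)` on `[0, T]`: sequences
of measurable functions such that `|a_i(x)| ^ (1 / i)` is bounded uniformly in `x ∈ [0, T]` and
`i ≥ 1`. (Values outside `[0, T]` are irrelevant for everything below.) -/
def coeffSpace (T : ℝ) : Set (ℕ+ → ℝ → ℂ) :=
  {a | (∀ i, Measurable (a i)) ∧
    ∃ C : ℝ, ∀ (i : ℕ+), ∀ x ∈ Set.Icc 0 T, ‖a i x‖ ≤ C ^ (i : ℕ)}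

/-- The coefficients `a` with `a_i = 0` for all `i > k`. -/
def coeffSpaceUpTo (T : ℝ) (k : ℕ) : Set (ℕ+ → ℝ → ℂ) :=
  {a | a ∈ coeffSpace T ∧ ∀ i : ℕ+, k < (i : ℕ) → ∀ x ∈ Set.Icc 0 T, a i x = 0}

/-- The coefficients of the solution `F` of `F'(x) = (∑ a_i(x) t ^ i X_i) F(x)`, `F(0) = I`,
obtained by Picard iteration. For the word `[i_k, …, i₁]` and `x = T` this is the basic iterated
integral
`I_{i₁, …, i_k}(a) = ∫_{0 ≤ s₁ ≤ ⋯ ≤ s_k ≤ T} a_{i_k}(s_k) ⋯ a_{i₁}(s₁) ds_k ⋯ ds₁`. -/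
def picard (a : ℕ+ → ℝ → ℂ) : List ℕ+ → ℝ → ℂ
  | [], _ => 1
  | i :: w, x => ∫ s in (0 : ℝ)..x, a i s * picard a w s

/-- The monodromy `E(a) = F(T)`. The sequences `a` and `b` represent the same element of the
group of paths if and only if `E(a) = E(b)`. -/
def monodromy (T : ℝ) (a : ℕ+ → ℝ → ℂ) : SeriesGroup :=
  ⟨fun w => picard a w T, rfl⟩

/-- The group `G_f(X)` of formal paths in `ℂ^∞`, realized in the group of series as the closure of
the group of paths `G(X) = E(X)`. -/
def formalPaths (T : ℝ) : Set SeriesGroup := closure (monodromy T '' coeffSpace T)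

/-- The group `G_f(X^k)` of formal paths in `ℂ^k`. -/
def formalPathsUpTo (T : ℝ) (k : ℕ) : Set SeriesGroup :=
  closure (monodromy T '' coeffSpaceUpTo T k)

/-- The set `G[[r]]` of formal power series `r + ∑_{i ≥ 1} d_i r ^ (i + 1)`. -/
def FormalGerm : Type := {f : ℂ⟦X⟧ // PowerSeries.coeff 0 f = 0 ∧ PowerSeries.coeff 1 f = 1}

namespace FormalGerm

/-- The coefficient `d_i`. -/
def d (f : FormalGerm) (i : ℕ+) : ℂ := PowerSeries.coeff ((i : ℕ) + 1) f.1

/-- The weakest topology in which all `d_i` are continuous. -/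
instance : TopologicalSpace FormalGerm :=
  TopologicalSpace.induced d inferInstance

/-- The series `r`, which is the unit of `G[[r]]` with respect to composition. -/
def id : FormalGerm :=
  ⟨PowerSeries.X, by simp, by simp⟩

end FormalGerm

/-- The polynomial
`p_{i₁, …, i_k}(t) = (t - i₁ + 1) (t - i₁ - i₂ + 1) ⋯ (t - i₁ - ⋯ - i_k + 1)`. -/
def pPoly : List ℕ → ℂ → ℂ
  | [], _ => 1
  | i :: w, t => (t - i + 1) * pPoly w (t - i)

/-- The first return map
`r + ∑_{i ≥ 1} (∑_{i₁ + ⋯ + i_k = i} p_{i₁, …, i_k}(i) I_{i₁, …, i_k}(g)) r ^ (i + 1)`.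
For `i = 0` the inner sum has just the term of the empty composition, which equals `1`. -/
def firstReturn (g : SeriesGroup) : FormalGerm :=
  ⟨PowerSeries.mk fun m => match m with
    | 0 => 0
    | i + 1 => ∑ c : Composition i,
        pPoly c.blocks (i : ℂ) * g.iteratedIntegral (c.blocks.map Nat.toPNat'),
    by simp, by
      have h : ∀ c : Composition 0, c.blocks = [] := fun c => c.blocks_eq_nil.mpr rfl
      simp [PowerSeries.coeff_mk, h, pPoly, SeriesGroup.iteratedIntegral, g.2,
        composition_card]⟩

/-- The group of formal centers, the kernel of the first return map on formal paths. -/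
def formalCenters (T : ℝ) : Set SeriesGroup :=
  {g | g ∈ formalPaths T ∧ firstReturn g = FormalGerm.id}

/-- The group of formal centers of Abel differential equations. -/
def abelFormalCenters (T : ℝ) : Set SeriesGroup := formalCenters T ∩ formalPathsUpTo T 2

/-- The sum `i₁ + ⋯ + i_k`. -/
def weight (w : List ℕ+) : ℕ := (w.map PNat.val).sum

/-- The iterated commutator `[X_{i₁}, [X_{i₂}, [⋯, [X_{i_{k-1}}, X_{i_k}] ⋯ ]]] t ^ n`, where
`n = i₁ + ⋯ + i_k`; the value at the empty word is irrelevant. -/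
def nestedBracket : List ℕ+ → Series
  | [] => 0
  | [i] => Series.X i
  | i :: j :: w => ⁅Series.X i, nestedBracket (j :: w)⁆

/-- The integers `γ_n = 1` and
`γ_{i₁, …, i_k} = (i_{k-1} - i_k) (i_{k-2} - i_{k-1} - i_k) ⋯ (i₁ - i₂ - ⋯ - i_k)` for `k ≥ 2`;
the value at the empty word is irrelevant. -/
def gam : List ℕ+ → ℤ
  | [] => 0
  | [_] => 1
  | i :: j :: w => ((i : ℕ) - (weight (j :: w) : ℤ)) * gam (j :: w)

/-- The elements `r_n t ^ n` for `n ≥ 2`: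
`r_n = ((-1) ^ n / (n - 2)!) [X₁, [X₁, ⋯, [X₁, X₂] ⋯ ]]` with `n - 2` brackets. -/
def rElem (n : ℕ) : Series :=
  ((-1 : ℂ) ^ n / ((n - 2).factorial : ℂ)) •
    nestedBracket (List.replicate (n - 2) (1 : ℕ+) ++ [2])

/-- The elements `l_{i₁, …, i_k} t ^ n`, where `n = i₁ + ⋯ + i_k`. -/
def lElem (w : List ℕ+) : Series :=
  nestedBracket w - (gam w : ℂ) • rElem (weight w)

/-- The group generated by all `exp (c l_{i₁, …, i_k} t ^ n)` with `c ∈ ℂ`, all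
`i_s ∈ {1, 2}` and `n = i₁ + ⋯ + i_k ≥ 5`. -/
def abelCenterGenerated : Subgroup SeriesGroup :=
  Subgroup.closure {g | ∃ (c : ℂ) (w : List ℕ+), (∀ i ∈ w, i = 1 ∨ i = 2) ∧ 5 ≤ weight w ∧
    g = SeriesGroup.exp (c • lElem w)}

end

end CenterProblem

open CenterProblem

open CenterProblem

/-! The proof rests on a description of formal paths: `formalPathsUpTo T 2` is exactly
`abelGroupLike`, the group of series in `X₁`, `X₂` that are characters of the shuffle algebra.
Iterated integrals satisfy the shuffle relations by integration by parts (`shuffleCoeff_picard`),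
and these relations are closed conditions, which gives one inclusion. For the other, the lowest
nontrivial weight component of a group-like series is primitive
(`IsGroupLike.isPrimitive_component`). By a weighted Dynkin formula
(`IsPrimitive.eq_sum_nestedBracket`) it is then a combination of nested brackets, and a bracket is
the leading term of a group commutator of exponentials of letters. Weight-by-weight approximation
(`subset_closure_of_approx`) makes the group generated by the `exp (c • X i)` dense, and its
elements are monodromies of piecewise constant paths.

The first return map becomes algebra through `action`: `X_i` acts as the vector field `r ^ (i + 1)
d/dr`, and the coefficients of the first return map of `g` are those of the image of `r` under `g`
(`d_firstReturn`). Vector fields are derivations, so a group-like series acts multiplicatively and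
is determined, as an operator, by the image of `r`. Hence the first return map of `f * g` depends on
a group-like `g` only through the first return map of `g` (`firstReturn_mul_congr`), and the fibres
in the path group are the left cosets of the centers.

For (1), the elements `X₁` and `r_n` act as `r ^ (n + 1) d/dr` for all `n ≥ 1`, so an infinite
product of their exponentials, with constants found recursively, realizes every germ. Each
coefficient of the product stabilizes after finitely many factors, whence continuity. The inverse
homeomorphism divides a path by the section value at its first return map.

For (2), the elements `l` act by zero, so their exponentials are centers. Conversely, the leading
component of a center is a primitive element killing `r`; writing it in nested brackets, the
multiples of `r_n` cancel and only the `l` remain. In weights 2, 3 and 4 every `l` is zero, which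
explains the bound 5. Approximation by weight finishes the proof. -/

namespace CenterProblem

/-! ### Shuffle coefficients, primitive and group-like series. -/

namespace Series

/-- Extensionality for series. -/
theorem ext_apply {f g : Series} (h : ∀ w, f w = g w) : f = g := funext h

theorem smul_apply (c : ℂ) (f : Series) (w : List ℕ+) : (c • f) w = c * f w := rfl

theorem neg_apply (f : Series) (w : List ℕ+) : (-f) w = -f w := rfl

theorem sum_apply {ι : Type*} (s : Finset ι) (F : ι → Series) (w : List ℕ+) :
    (∑ i ∈ s, F i) w = ∑ i ∈ s, F i w := Finset.sum_apply w s F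

theorem smul_mul_series (c : ℂ) (f g : Series) : (c • f) * g = c • (f * g) := by
  refine ext_apply fun w => ?_
  simp only [mul_apply, smul_apply, Finset.mul_sum, mul_assoc]

theorem mul_smul_series (c : ℂ) (f g : Series) : f * (c • g) = c • (f * g) := by
  refine ext_apply fun w => ?_
  simp only [mul_apply, smul_apply, Finset.mul_sum]
  exact Finset.sum_congr rfl fun _ _ => by ring

theorem shift_apply (f : Series) (i : ℕ+) (w : List ℕ+) : f.shift i w = f (i :: w) := rfl

/-- Left differentiation by a letter, as a linear map. -/
def shiftₗ (i : ℕ+) : Series →ₗ[ℂ] Series where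
  toFun f := f.shift i
  map_add' _ _ := rfl
  map_smul' _ _ := rfl

theorem shift_mul (f g : Series) (i : ℕ+) :
    (f * g).shift i = f [] • g.shift i + f.shift i * g :=
  ext_apply fun w => mul_cons f g i w

/-- The sum of the coefficients of a series over all shuffles of two words. -/
noncomputable def shuffleCoeff : List ℕ+ → List ℕ+ → Series →ₗ[ℂ] ℂ
  | [], v => LinearMap.proj v
  | i :: u, [] => LinearMap.proj (i :: u)
  | i :: u, j :: v =>
    (shuffleCoeff u (j :: v)).comp (shiftₗ i) + (shuffleCoeff (i :: u) v).comp (shiftₗ j)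
  termination_by u v => u.length + v.length

theorem shuffleCoeff_nil_left (v : List ℕ+) (f : Series) : shuffleCoeff [] v f = f v := by
  rw [shuffleCoeff]; rfl

theorem shuffleCoeff_nil_right (u : List ℕ+) (f : Series) : shuffleCoeff u [] f = f u := by
  cases u with
  | nil => exact shuffleCoeff_nil_left _ _
  | cons i u => rw [shuffleCoeff]; rfl

theorem shuffleCoeff_cons_cons (i j : ℕ+) (u v : List ℕ+) (f : Series) :
    shuffleCoeff (i :: u) (j :: v) f =
      shuffleCoeff u (j :: v) (f.shift i) + shuffleCoeff (i :: u) v (f.shift j) := by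
  rw [shuffleCoeff]; rfl

/-- Shuffles of `u` and `v` are permutations of `u ++ v`. -/
theorem shuffleCoeff_congr {u v : List ℕ+} {F G : Series}
    (h : ∀ w : List ℕ+, w.Perm (u ++ v) → F w = G w) :
    shuffleCoeff u v F = shuffleCoeff u v G := by
  match u, v with
  | [], v =>
    rw [shuffleCoeff_nil_left, shuffleCoeff_nil_left]
    exact h v (by simp)
  | i :: u, [] =>
    rw [shuffleCoeff_nil_right, shuffleCoeff_nil_right]
    exact h (i :: u) (by simp)
  | i :: u, j :: v =>
    rw [shuffleCoeff_cons_cons, shuffleCoeff_cons_cons]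
    congr 1
    · exact shuffleCoeff_congr fun w hw => h (i :: w) (hw.cons i)
    · exact shuffleCoeff_congr fun w hw => h (j :: w)
        ((hw.cons j).trans List.perm_middle.symm)
  termination_by u.length + v.length

/-- Shuffling and deconcatenation form a bialgebra: cutting a shuffle of `u` and `v` in two amounts
to cutting `u` and `v` separately and shuffling the pieces. The induction removes the first letter
of the shuffle. -/
theorem shuffleCoeff_mul (u v : List ℕ+) (f g : Series) :
    shuffleCoeff u v (f * g) = ∑ p ∈ Finset.range (u.length + 1),
      ∑ q ∈ Finset.range (v.length + 1),
        shuffleCoeff (u.take p) (v.take q) f * shuffleCoeff (u.drop p) (v.drop q) g := by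
  match u, v with
  | [], v => simp [shuffleCoeff_nil_left, mul_apply]
  | i :: u, [] => simp [shuffleCoeff_nil_right, mul_apply]
  | i :: u, j :: v =>
    have h1 := shuffleCoeff_mul u (j :: v) (f.shift i) g
    have h2 := shuffleCoeff_mul (i :: u) v (f.shift j) g
    rw [shuffleCoeff_cons_cons, shift_mul, shift_mul, map_add, map_add, map_smul, map_smul,
      h1, h2]
    simp only [List.length_cons]
    rw [Finset.sum_range_succ' _ (u.length + 1), Finset.sum_range_succ' _ (u.length + 1)]
    simp only [Finset.sum_range_succ' _ (v.length + 1), List.take_succ_cons, List.drop_succ_cons,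
      List.take_zero, List.drop_zero, shuffleCoeff_nil_left, shuffleCoeff_nil_right,
      shuffleCoeff_cons_cons, shift_apply, add_mul, Finset.sum_add_distrib, smul_eq_mul]
    ring
  termination_by u.length + v.length

theorem continuous_coeff (w : List ℕ+) : Continuous fun f : Series => f w :=
  continuous_apply (A := fun _ : List ℕ+ => ℂ) w

theorem continuous_of_coeff {Y : Type*} [TopologicalSpace Y] {F : Y → Series}
    (h : ∀ w, Continuous fun y => F y w) : Continuous F :=
  continuous_pi (A := fun _ : List ℕ+ => ℂ) h

theorem continuous_shift (i : ℕ+) : Continuous fun f : Series => f.shift i :=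
  continuous_of_coeff fun w => continuous_coeff (i :: w)

theorem continuous_shuffleCoeff (u v : List ℕ+) : Continuous (shuffleCoeff u v) := by
  match u, v with
  | [], v => exact (continuous_coeff v).congr fun f => (shuffleCoeff_nil_left v f).symm
  | i :: u, [] =>
    exact (continuous_coeff (i :: u)).congr fun f => (shuffleCoeff_nil_right (i :: u) f).symm
  | i :: u, j :: v =>
    have h := ((continuous_shuffleCoeff u (j :: v)).comp (continuous_shift i)).add
      ((continuous_shuffleCoeff (i :: u) v).comp (continuous_shift j))
    exact h.congr fun f => (shuffleCoeff_cons_cons i j u v f).symm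
  termination_by u.length + v.length

/-- A series is primitive if it vanishes on all shuffle products of nonempty words. -/
def IsPrimitive (f : Series) : Prop :=
  f [] = 0 ∧ ∀ u v, u ≠ [] → v ≠ [] → shuffleCoeff u v f = 0

/-- A series is group-like if it is a character of the shuffle algebra. -/
def IsGroupLike (f : Series) : Prop := ∀ u v, shuffleCoeff u v f = f u * f v

theorem isGroupLike_one : IsGroupLike 1 := by
  intro u v
  match u, v with
  | [], v => rw [shuffleCoeff_nil_left, one_nil, one_mul]
  | u, [] => rw [shuffleCoeff_nil_right, one_nil, mul_one]
  | a :: u, b :: v =>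
    have e : ∀ c, (1 : Series).shift c = 0 := fun c => rfl
    rw [shuffleCoeff_cons_cons, e, e, map_zero, map_zero, one_cons, zero_mul, add_zero]

theorem IsPrimitive.smul {f : Series} (hf : IsPrimitive f) (c : ℂ) : IsPrimitive (c • f) :=
  ⟨by rw [smul_apply, hf.1, mul_zero], fun u v hu hv => by
    rw [map_smul, hf.2 u v hu hv, smul_zero]⟩

theorem IsPrimitive.sub {f g : Series} (hf : IsPrimitive f) (hg : IsPrimitive g) :
    IsPrimitive (f - g) :=
  ⟨by rw [sub_apply, hf.1, hg.1, sub_zero], fun u v hu hv => by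
    rw [map_sub, hf.2 u v hu hv, hg.2 u v hu hv, sub_zero]⟩

theorem isPrimitive_zero : IsPrimitive 0 := ⟨rfl, fun _ _ _ _ => map_zero _⟩

theorem X_shift (i j : ℕ+) : (X i).shift j = if j = i then 1 else 0 := by
  refine ext_apply fun w => ?_
  change (if j :: w = [i] then (1 : ℂ) else 0) = _
  by_cases h : j = i
  · subst h
    simp only [List.cons.injEq, true_and, if_true]
    rfl
  · simp [h, zero_apply]

theorem isPrimitive_X (i : ℕ+) : IsPrimitive (X i) := by
  refine ⟨rfl, fun u v hu hv => ?_⟩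
  match u, v, hu, hv with
  | j :: u, k :: v, _, _ =>
    rw [shuffleCoeff_cons_cons, X_shift, X_shift]
    split_ifs <;> simp [isGroupLike_one _ _, one_cons]

/-- In the double sum of `Series.shuffleCoeff_mul` the terms with both prefixes nonempty vanish by
primitivity, and so does the one with both empty. What remains is the coproduct `f ⊗ 1 + 1 ⊗ f`
acting on `g`. -/
theorem IsPrimitive.shuffleCoeff_mul {f : Series} (hf : IsPrimitive f) (g : Series)
    (u v : List ℕ+) :
    shuffleCoeff u v (f * g) =
      (∑ p ∈ Finset.range (u.length + 1), f (u.take p) * shuffleCoeff (u.drop p) v g) +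
      ∑ q ∈ Finset.range (v.length + 1), f (v.take q) * shuffleCoeff u (v.drop q) g := by
  rw [Series.shuffleCoeff_mul, Finset.sum_range_succ']
  have h1 : ∀ p ∈ Finset.range u.length,
      ∑ q ∈ Finset.range (v.length + 1),
        shuffleCoeff (u.take (p + 1)) (v.take q) f * shuffleCoeff (u.drop (p + 1)) (v.drop q) g =
      f (u.take (p + 1)) * shuffleCoeff (u.drop (p + 1)) v g := by
    intro p hp
    rw [Finset.sum_range_succ', Finset.sum_eq_zero, zero_add]
    · simp [shuffleCoeff_nil_right]
    · intro q hq
      rw [hf.2, zero_mul]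
      · intro h
        have := congrArg List.length h
        simp at this hp
        subst this
        simp at hp
      · intro h
        have := congrArg List.length h
        simp at this hq
        subst this
        simp at hq
  rw [Finset.sum_congr rfl h1, Finset.sum_range_succ' (fun p => f (u.take p) * _)]
  simp [shuffleCoeff_nil_left, hf.1]

theorem IsPrimitive.shuffleCoeff_mul_of_ne_nil {f g : Series} (hf : IsPrimitive f)
    (hg : IsPrimitive g) {u v : List ℕ+} (hu : u ≠ []) (hv : v ≠ []) :
    shuffleCoeff u v (f * g) = f u * g v + f v * g u := by
  rw [hf.shuffleCoeff_mul, Finset.sum_range_succ, Finset.sum_eq_zero,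
    Finset.sum_range_succ, Finset.sum_eq_zero]
  · simp [shuffleCoeff_nil_left, shuffleCoeff_nil_right]
  · intro q hq
    rw [hg.2 _ _ hu, mul_zero]
    simpa using hq
  · intro q hq
    rw [hg.2 _ _ _ hv, mul_zero]
    simpa using hq

/-- On a shuffle of nonempty words the value of `f * g` is symmetric in `f` and `g`, so it cancels
in the commutator. -/
theorem IsPrimitive.lie {f g : Series} (hf : IsPrimitive f) (hg : IsPrimitive g) :
    IsPrimitive ⁅f, g⁆ := by
  rw [Ring.lie_def]
  refine ⟨by rw [sub_apply, mul_nil, mul_nil]; ring, fun u v hu hv => ?_⟩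
  rw [map_sub, hf.shuffleCoeff_mul_of_ne_nil hg hu hv, hg.shuffleCoeff_mul_of_ne_nil hf hu hv]
  ring

/-- The binomial theorem for the commuting operators `f ⊗ 1` and `1 ⊗ f`. -/
theorem IsPrimitive.shuffleCoeff_pow {f : Series} (hf : IsPrimitive f) (n : ℕ) :
    ∀ u v : List ℕ+, shuffleCoeff u v (f ^ n) =
      ∑ ij ∈ Finset.HasAntidiagonal.antidiagonal n, (n.choose ij.1 : ℂ) * ((f ^ ij.1) u * (f ^ ij.2) v) := by
  induction n with
  | zero =>
    intro u v
    simp only [pow_zero, Finset.Nat.antidiagonal_zero, Finset.sum_singleton, Nat.choose_self,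
      Nat.cast_one, one_mul]
    exact isGroupLike_one u v
  | succ n ih =>
    intro u v
    rw [pow_succ', hf.shuffleCoeff_mul]
    simp only [ih, Finset.mul_sum]
    rw [Finset.sum_comm, Finset.sum_comm (s := Finset.range (v.length + 1)),
      Finset.sum_antidiagonal_choose_succ_mul (fun i j => (f ^ i) u * (f ^ j) v) n, add_comm]
    congr 1
    · refine Finset.sum_congr rfl fun ij _ => ?_
      rw [pow_succ', mul_apply, Finset.mul_sum, Finset.mul_sum]
      exact Finset.sum_congr rfl fun _ _ => by ring
    · refine Finset.sum_congr rfl fun ij hij => ?_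
      rw [Nat.choose_symm_of_eq_add (Finset.HasAntidiagonal.mem_antidiagonal.mp hij).symm,
        pow_succ' f ij.1, mul_apply, Finset.sum_mul, Finset.mul_sum]
      exact Finset.sum_congr rfl fun _ _ => by ring

end Series

open Series

/-! ### Exponentials, the closed group of group-like series, continuity of the group operations. -/

namespace SeriesGroup

theorem ext_apply {f g : SeriesGroup} (h : ∀ w, f.1 w = g.1 w) : f = g :=
  Subtype.ext (funext h)

theorem coe_mul (f g : SeriesGroup) : (f * g).1 = f.1 * g.1 := rfl

theorem coe_one : (1 : SeriesGroup).1 = 1 := rfl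

theorem coe_inv_mul (f : SeriesGroup) : (f⁻¹).1 * f.1 = 1 := by
  rw [← coe_mul, inv_mul_cancel, coe_one]

theorem exp_apply {f : Series} (h0 : f [] = 0) {N : ℕ} {w : List ℕ+} (h : w.length < N) :
    (exp f).1 w = ∑ n ∈ Finset.range N, (f ^ n) w / (n.factorial : ℂ) := by
  change ∑ n ∈ Finset.range (w.length + 1), (f ^ n) w / (n.factorial : ℂ) = _
  refine Finset.sum_subset (fun n hn => ?_) (fun n _ hn => ?_)
  · simp only [Finset.mem_range] at hn ⊢; omega
  · simp only [Finset.mem_range] at hn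
    rw [pow_apply_eq_zero _ h0 n w (by omega), zero_div]

theorem exp_shuffleCoeff {f : Series} (h0 : f [] = 0) (u v : List ℕ+) {N : ℕ}
    (h : u.length + v.length < N) :
    shuffleCoeff u v (exp f).1 =
      ∑ n ∈ Finset.range N, shuffleCoeff u v (f ^ n) / (n.factorial : ℂ) := by
  rw [shuffleCoeff_congr (G := ∑ n ∈ Finset.range N, (n.factorial : ℂ)⁻¹ • f ^ n), map_sum]
  · refine Finset.sum_congr rfl fun n _ => ?_
    rw [map_smul, smul_eq_mul, div_eq_inv_mul]
  · intro w hw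
    rw [exp_apply h0 (by rw [hw.length_eq, List.length_append]; exact h), Series.sum_apply]
    exact Finset.sum_congr rfl fun n _ => div_eq_inv_mul _ _

theorem isGroupLike_exp {f : Series} (hf : IsPrimitive f) : IsGroupLike (exp f).1 := by
  intro u v
  -- Exponents below `M` suffice for `u` and for `v`. Truncating the left side at `2 * M` makes its
  -- antidiagonals cover the whole square of pairs below `M`; the extra pairs contribute zero
  -- because a power exceeds the length of its word.
  set M := u.length + v.length + 1 with hM
  rw [exp_shuffleCoeff hf.1 u v (N := 2 * M) (by omega),
    exp_apply hf.1 (N := M) (show u.length < M by omega),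
    exp_apply hf.1 (N := M) (show v.length < M by omega), Finset.sum_mul_sum,
    ← Finset.sum_product']
  have h1 : ∀ n ∈ Finset.range (2 * M), shuffleCoeff u v (f ^ n) / (n.factorial : ℂ) =
      ∑ ij ∈ Finset.HasAntidiagonal.antidiagonal n,
        (f ^ ij.1) u / (ij.1.factorial : ℂ) * ((f ^ ij.2) v / (ij.2.factorial : ℂ)) := by
    intro n _
    rw [hf.shuffleCoeff_pow, Finset.sum_div]
    refine Finset.sum_congr rfl fun ij hij => ?_
    rw [Finset.HasAntidiagonal.mem_antidiagonal] at hij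
    have e : (n.choose ij.1 : ℂ) * (ij.1.factorial * ij.2.factorial) = n.factorial := by
      rw [← hij, ← mul_assoc, Nat.choose_symm_add]
      exact_mod_cast Nat.add_choose_mul_factorial_mul_factorial ij.1 ij.2
    have n1 : (ij.1.factorial : ℂ) ≠ 0 := Nat.cast_ne_zero.mpr (Nat.factorial_ne_zero _)
    have n2 : (ij.2.factorial : ℂ) ≠ 0 := Nat.cast_ne_zero.mpr (Nat.factorial_ne_zero _)
    have n3 : (n.factorial : ℂ) ≠ 0 := Nat.cast_ne_zero.mpr (Nat.factorial_ne_zero _)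
    rw [div_mul_div_comm, div_eq_div_iff n3 (mul_ne_zero n1 n2), ← e]
    ring
  rw [Finset.sum_congr rfl h1, Finset.sum_sigma']
  refine (Finset.sum_subset_zero_on_sdiff (s₁ := Finset.range M ×ˢ Finset.range M)
    (s₂ := ((Finset.range (2 * M)).sigma fun n => Finset.HasAntidiagonal.antidiagonal n).image (fun x => x.2))
    (f := fun ij : ℕ × ℕ => (f ^ ij.1) u / (ij.1.factorial : ℂ) *
      ((f ^ ij.2) v / (ij.2.factorial : ℂ)))
    (g := fun ij : ℕ × ℕ => (f ^ ij.1) u / (ij.1.factorial : ℂ) *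
      ((f ^ ij.2) v / (ij.2.factorial : ℂ))) ?_ ?_ (fun _ _ => rfl) |>.trans ?_).symm
  · intro ij hij
    simp only [Finset.mem_product, Finset.mem_range] at hij
    refine Finset.mem_image.mpr ⟨⟨ij.1 + ij.2, ij⟩, ?_, rfl⟩
    simp only [Finset.mem_sigma, Finset.mem_range, Finset.HasAntidiagonal.mem_antidiagonal, and_true]
    omega
  · intro ij hij
    simp only [Finset.mem_sdiff, Finset.mem_product, Finset.mem_range, not_and_or] at hij
    rcases hij.2 with h | h
    · rw [pow_apply_eq_zero f hf.1 ij.1 u (by omega), zero_div, zero_mul]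
    · rw [pow_apply_eq_zero f hf.1 ij.2 v (by omega), zero_div, mul_zero]
  · refine Finset.sum_image ?_
    rintro ⟨n, a⟩ h1 ⟨m, b⟩ h2 h
    simp only [Finset.coe_sigma, Set.mem_sigma_iff, Finset.mem_coe, Finset.HasAntidiagonal.mem_antidiagonal] at h1 h2
    obtain rfl : a = b := h
    obtain rfl : n = m := h1.2.symm.trans h2.2
    rfl

/-- The group of group-like series. -/
def groupLike : Subgroup SeriesGroup where
  carrier := {g | IsGroupLike g.1}
  one_mem' := isGroupLike_one
  mul_mem' {f g} hf hg u v := by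
    rw [coe_mul, shuffleCoeff_mul, mul_apply, mul_apply, Finset.sum_mul_sum]
    refine Finset.sum_congr rfl fun p _ => Finset.sum_congr rfl fun q _ => ?_
    rw [hf, hg]; ring
  inv_mem' {g} hg := by
    -- Both sides of the relation for `g⁻¹ * g = 1` are expanded over pairs of prefixes. By
    -- induction all pairs other than the full words agree, so the terms for the full words agree
    -- too.
    have key : ∀ (n : ℕ) (u v : List ℕ+), u.length + v.length = n →
        shuffleCoeff u v (g⁻¹).1 = (g⁻¹).1 u * (g⁻¹).1 v := by
      intro n
      induction n using Nat.strong_induction_on with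
      | _ n ih =>
        intro u v hn
        have e1 := shuffleCoeff_mul u v (g⁻¹).1 g.1
        have e2 : ((g⁻¹).1 * g.1) u * ((g⁻¹).1 * g.1) v =
            shuffleCoeff u v ((g⁻¹).1 * g.1) := by
          rw [coe_inv_mul]
          exact (isGroupLike_one u v).symm
        rw [← e2, mul_apply, mul_apply, Finset.sum_mul_sum, ← sub_eq_zero,
          ← Finset.sum_sub_distrib] at e1
        simp only [← Finset.sum_sub_distrib] at e1
        rw [Finset.sum_eq_single u.length, Finset.sum_eq_single v.length] at e1
        · simp only [List.take_length, List.drop_length, shuffleCoeff_nil_left, g.2] at e1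
          linear_combination -e1
        · intro q hq hq'
          simp only [Finset.mem_range] at hq
          rw [hg, ih _ _ _ _ rfl]
          · ring
          · simp only [List.length_take]; omega
        · simp
        · intro p hp hp'
          simp only [Finset.mem_range] at hp
          refine Finset.sum_eq_zero fun q hq => ?_
          simp only [Finset.mem_range] at hq
          rw [hg, ih _ _ _ _ rfl]
          · ring
          · simp only [List.length_take]; omega
        · simp
    intro u v
    exact key _ u v rfl

theorem mem_groupLike {g : SeriesGroup} : g ∈ groupLike ↔ IsGroupLike g.1 := Iff.rfl

theorem continuous_coeff (w : List ℕ+) : Continuous fun g : SeriesGroup => g.1 w :=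
  (Series.continuous_coeff w).comp continuous_subtype_val

theorem continuous_of_coeff {Y : Type*} [TopologicalSpace Y] {F : Y → SeriesGroup}
    (h : ∀ w, Continuous fun y => (F y).1 w) : Continuous F :=
  Continuous.subtype_mk (Series.continuous_of_coeff h) _

theorem continuous_mul_group {Y : Type*} [TopologicalSpace Y] {F G : Y → SeriesGroup}
    (hF : Continuous F) (hG : Continuous G) : Continuous fun y => F y * G y := by
  refine continuous_of_coeff fun w => ?_
  simp only [coe_mul, mul_apply]
  exact continuous_finsetSum _ fun j _ =>
    ((continuous_coeff _).comp hF).mul ((continuous_coeff _).comp hG)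

theorem continuous_inv_group : Continuous fun g : SeriesGroup => g⁻¹ := by
  refine continuous_of_coeff fun w => ?_
  have key : ∀ (n : ℕ) (w : List ℕ+), Continuous fun g : SeriesGroup => ((1 - g.1) ^ n) w := by
    intro n
    induction n with
    | zero => intro w; simp only [pow_zero]; exact continuous_const
    | succ n ih =>
      intro w
      simp only [pow_succ, mul_apply, sub_apply]
      exact continuous_finsetSum _ fun j _ =>
        (ih _).mul (continuous_const.sub (continuous_coeff _))
  exact continuous_finsetSum (Finset.range (w.length + 1)) fun n _ => key n w

theorem continuous_exp_smul {Y : Type*} [TopologicalSpace Y] {c : Y → ℂ} (hc : Continuous c)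
    (f : Series) : Continuous fun y => exp (c y • f) := by
  refine continuous_of_coeff fun w => ?_
  have key : ∀ (n : ℕ) (w : List ℕ+), Continuous fun y => ((c y • f) ^ n) w := by
    intro n
    induction n with
    | zero => intro w; simp only [pow_zero]; exact continuous_const
    | succ n ih =>
      intro w
      simp only [pow_succ, mul_apply, smul_apply]
      exact continuous_finsetSum _ fun j _ => (ih _).mul (hc.mul continuous_const)
  exact continuous_finsetSum (Finset.range (w.length + 1)) fun n _ => (key n w).div_const _

theorem isClosed_groupLike : IsClosed (groupLike : Set SeriesGroup) := by
  have : (groupLike : Set SeriesGroup) =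
      ⋂ u, ⋂ v, {g | shuffleCoeff u v g.1 = g.1 u * g.1 v} := by
    ext g; simp [mem_groupLike, IsGroupLike]
  rw [this]
  exact isClosed_iInter fun u => isClosed_iInter fun v => isClosed_eq
    ((continuous_shuffleCoeff u v).comp continuous_subtype_val)
    ((continuous_coeff u).mul (continuous_coeff v))

end SeriesGroup

end CenterProblem

/-! ### Weights, nested brackets and the weighted Dynkin formula. -/

namespace CenterProblem

open Series SeriesGroup

theorem weight_nil : weight [] = 0 := rfl

theorem weight_cons (i : ℕ+) (w : List ℕ+) : weight (i :: w) = i + weight w := by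
  simp [weight]

theorem weight_append (u v : List ℕ+) : weight (u ++ v) = weight u + weight v := by
  simp [weight]

theorem weight_take_add_drop (j : ℕ) (w : List ℕ+) :
    weight (w.take j) + weight (w.drop j) = weight w := by
  rw [← weight_append, List.take_append_drop]

theorem weight_perm {u v : List ℕ+} (h : u.Perm v) : weight u = weight v :=
  (h.map _).sum_eq

theorem weight_pos {w : List ℕ+} (h : w ≠ []) : 0 < weight w := by
  obtain ⟨i, w, rfl⟩ := List.exists_cons_of_ne_nil h
  rw [weight_cons]
  exact Nat.add_pos_left i.pos _

theorem weight_eq_zero {w : List ℕ+} : weight w = 0 ↔ w = [] :=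
  ⟨fun h => by_contra fun h' => (weight_pos h').ne' h, fun h => h ▸ rfl⟩

/-- The words of weight `n`. -/
def words (n : ℕ) : Finset (List ℕ+) :=
  (Finset.univ : Finset (Composition n)).image fun c => c.blocks.map Nat.toPNat'

theorem map_val_map_toPNat' {l : List ℕ} (h : ∀ i ∈ l, 0 < i) :
    (l.map Nat.toPNat').map PNat.val = l := by
  rw [List.map_map]
  conv_rhs => rw [← List.map_id l]
  refine List.map_congr_left fun i hi => ?_
  exact PNat.toPNat'_coe (h i hi)

theorem mem_words {n : ℕ} {w : List ℕ+} : w ∈ words n ↔ weight w = n := by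
  constructor
  · intro h
    obtain ⟨c, -, rfl⟩ := Finset.mem_image.mp h
    rw [weight, map_val_map_toPNat' fun i hi => c.blocks_pos hi, c.blocks_sum]
  · intro h
    refine Finset.mem_image.mpr ⟨⟨w.map PNat.val, ?_, h⟩, Finset.mem_univ _, ?_⟩
    · intro i hi
      obtain ⟨j, -, rfl⟩ := List.mem_map.mp hi
      exact j.pos
    · rw [List.map_map]
      conv_rhs => rw [← List.map_id w]
      exact List.map_congr_left fun i _ => PNat.coe_toPNat' i

theorem sum_words_of_head {M : Type*} [AddCommMonoid M] (a : ℕ+) (m : ℕ) (G : List ℕ+ → M)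
    (h : ∀ i w, i ≠ a → G (i :: w) = 0) :
    ∑ w ∈ words (a + m), G w = ∑ w ∈ words m, G (a :: w) := by
  symm
  rw [← Finset.sum_image (s := words m) (g := fun w => a :: w) (f := G)
    (fun _ _ _ _ e => (List.cons.inj e).2)]
  refine Finset.sum_subset (fun w hw => ?_) fun w hw hw' => ?_
  · obtain ⟨v, hv, rfl⟩ := Finset.mem_image.mp hw
    rw [mem_words] at hv ⊢
    rw [weight_cons, hv]
  · rw [mem_words] at hw
    match w with
    | [] =>
      rw [weight_nil] at hw
      exact absurd hw (Nat.add_pos_left a.pos m).ne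
    | i :: v =>
      by_cases hi : i = a
      · subst hi
        rw [weight_cons] at hw
        exact absurd (Finset.mem_image_of_mem _ (mem_words.mpr (by omega))) hw'
      · exact h i v hi

namespace Series

/-- Homogeneity with respect to the weight. -/
def IsHomogeneous (n : ℕ) (f : Series) : Prop := ∀ w, weight w ≠ n → f w = 0

theorem IsHomogeneous.mul {m n : ℕ} {f g : Series} (hf : IsHomogeneous m f)
    (hg : IsHomogeneous n g) : IsHomogeneous (m + n) (f * g) := by
  intro w hw
  refine Finset.sum_eq_zero fun j _ => ?_
  have := weight_take_add_drop j w
  by_cases h : weight (w.take j) = m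
  · rw [hg _ (by omega), mul_zero]
  · rw [hf _ h, zero_mul]

theorem IsHomogeneous.sub {n : ℕ} {f g : Series} (hf : IsHomogeneous n f)
    (hg : IsHomogeneous n g) : IsHomogeneous n (f - g) := fun w hw => by
  rw [sub_apply, hf w hw, hg w hw, sub_zero]

theorem IsHomogeneous.smul {n : ℕ} {f : Series} (hf : IsHomogeneous n f) (c : ℂ) :
    IsHomogeneous n (c • f) := fun w hw => by rw [smul_apply, hf w hw, mul_zero]

theorem isHomogeneous_X (i : ℕ+) : IsHomogeneous i (X i) := by
  intro w hw
  refine if_neg ?_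
  rintro rfl
  simp [weight] at hw

theorem isHomogeneous_nestedBracket (w : List ℕ+) :
    IsHomogeneous (weight w) (nestedBracket w) := by
  match w with
  | [] => exact fun _ _ => rfl
  | [i] => simpa [weight, nestedBracket] using isHomogeneous_X i
  | i :: j :: w =>
    have ih := isHomogeneous_nestedBracket (j :: w)
    rw [nestedBracket, Ring.lie_def, weight_cons]
    exact ((isHomogeneous_X i).mul ih).sub (add_comm (i : ℕ) _ ▸ ih.mul (isHomogeneous_X i))

theorem isPrimitive_nestedBracket (w : List ℕ+) : IsPrimitive (nestedBracket w) := by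
  match w with
  | [] => exact isPrimitive_zero
  | [i] => exact isPrimitive_X i
  | i :: j :: w => exact (isPrimitive_X i).lie (isPrimitive_nestedBracket (j :: w))

theorem X_mul_cons (i a : ℕ+) (f : Series) (t : List ℕ+) :
    (X i * f) (a :: t) = if a = i then f t else 0 := by
  rw [mul_cons, X_shift]
  have : X i [] = 0 := rfl
  rw [this, zero_mul, zero_add]
  split_ifs
  · rw [one_mul]
  · rw [zero_mul]; rfl

theorem mul_X_append (i b : ℕ+) (s : List ℕ+) :
    ∀ f : Series, (f * X i) (s ++ [b]) = if b = i then f s else 0 := by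
  have h0 : X i [] = 0 := rfl
  induction s with
  | nil =>
    intro f
    rw [List.nil_append, mul_cons, mul_nil, h0, mul_zero, add_zero]
    change f [] * (if [b] = [i] then 1 else 0) = _
    simp
  | cons c s ih =>
    intro f
    rw [List.cons_append, mul_cons, ih]
    have : X i (c :: (s ++ [b])) = 0 := if_neg (by simp)
    rw [this, mul_zero, zero_add]; rfl

/-- In `X_i Q - Q X_i` the first product is read off by deleting the first letter and the second by
deleting the last one. The value zero of `nestedBracket []` makes the formula hold for a single
letter too, as `a :: t` has length at least two. -/
theorem nestedBracket_cons_apply (i a b : ℕ+) (w t s : List ℕ+) (ht : t ≠ [])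
    (h : a :: t = s ++ [b]) :
    nestedBracket (i :: w) (a :: t) =
      (if a = i then nestedBracket w t else 0) - if b = i then nestedBracket w s else 0 := by
  match w with
  | [] =>
    have : X i (a :: t) = 0 := if_neg (by simp [ht])
    simp [nestedBracket, this, zero_apply]
  | j :: w =>
    rw [nestedBracket, Ring.lie_def, sub_apply, X_mul_cons, h, mul_X_append]

/-- The last letter of a word, as a number. -/
def lastLetter (w : List ℕ+) : ℂ := ((w.getLastD 1 : ℕ+) : ℕ)

/-- The image of a series under the Dynkin operator weighted by the last letter. -/
noncomputable def dynkin (P : Series) (x : List ℕ+) : ℂ :=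
  ∑ w ∈ words (weight x), lastLetter w * P w * nestedBracket w x

/-- The convolution of the antipode with a multiple of the identity plus the weight derivation. -/
noncomputable def antipodeSum (α : ℂ) (P : Series) (x : List ℕ+) : ℂ :=
  ∑ j ∈ Finset.range (x.length + 1), (α + weight (x.take j)) *
    ((-1) ^ (x.length + j) * shuffleCoeff (x.take j) (x.drop j).reverse P)

theorem dynkin_singleton (P : Series) (i : ℕ+) : dynkin P [i] = i * P [i] := by
  rw [dynkin, Finset.sum_eq_single [i]]
  · simp [lastLetter, nestedBracket, X]
  · intro w _ hw'
    match w with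
    | [] => simp [nestedBracket, zero_apply]
    | [j] =>
      have : X j [i] = 0 := if_neg fun e => hw' e.symm
      rw [nestedBracket, this, mul_zero]
    | j :: k :: w =>
      have h := isHomogeneous_nestedBracket (k :: w) [] (by
        rw [weight_nil]; exact (weight_pos (by simp)).ne)
      have h1 := X_mul_cons j i (nestedBracket (k :: w)) []
      have h2 := mul_X_append j i [] (nestedBracket (k :: w))
      rw [List.nil_append] at h2
      rw [nestedBracket, Ring.lie_def, sub_apply, h1, h2, h]
      simp
  · intro h
    exact absurd (mem_words.mpr rfl) h

/-- This recursion at the two ends of the word, together with the values on single letters,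
determines `dynkin`; `antipodeSum` obeys the same one. -/
theorem dynkin_cons (P : Series) (a b : ℕ+) (t s : List ℕ+) (ht : t ≠ [])
    (h : a :: t = s ++ [b]) :
    dynkin P (a :: t) = dynkin (P.shift a) t - dynkin (P.shift b) s := by
  have hs : s ≠ [] := by
    rintro rfl
    simp at h
    exact ht h.2
  have hw : weight (a :: t) = b + weight s := by
    rw [h, weight_append, add_comm]; simp [weight]
  have key : ∀ (c : ℕ+) (r : List ℕ+), r ≠ [] → weight (a :: t) = c + weight r →
      ∑ w ∈ words (weight (a :: t)), lastLetter w * P w *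
        (if c = w.headD 1 then nestedBracket w.tail r else 0) = dynkin (P.shift c) r := by
    intro c r hr hwr
    rw [hwr, sum_words_of_head]
    · refine Finset.sum_congr rfl fun w hw' => ?_
      have hw0 : w ≠ [] := by
        rintro rfl
        rw [mem_words, weight_nil] at hw'
        exact (weight_pos hr).ne hw'
      obtain ⟨k, w, rfl⟩ := List.exists_cons_of_ne_nil hw0
      simp [lastLetter, shift_apply]
    · intro i w hi
      simp [hi.symm]
  rw [← key a t ht (weight_cons a t), ← key b s hs hw, dynkin, ← Finset.sum_sub_distrib]
  refine Finset.sum_congr rfl fun w hw' => ?_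
  match w with
  | [] =>
    rw [mem_words, weight_nil] at hw'
    exact absurd hw' (weight_pos (by simp)).ne
  | i :: w =>
    rw [nestedBracket_cons_apply i a b w t s ht h]
    simp only [List.headD_cons, List.tail_cons]
    rw [mul_sub]
    by_cases ha : a = i <;> by_cases hb : b = i <;> simp only [ha, hb, if_true, if_false, mul_zero]

theorem antipodeSum_singleton (α : ℂ) (P : Series) (i : ℕ+) :
    antipodeSum α P [i] = i * P [i] := by
  simp [antipodeSum, Finset.sum_range_succ, shuffleCoeff_nil_left, shuffleCoeff_nil_right, weight]
  ring

/-- The shuffle of a prefix with a reversed suffix starts with `a` or with `b`, which splits each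
inner term in two. Deleting `a` lowers the weight of every prefix by `a`; the parameter `α` absorbs
this shift. -/
theorem antipodeSum_cons (α : ℂ) (P : Series) (a b : ℕ+) (y : List ℕ+) :
    antipodeSum α P (a :: (y ++ [b])) =
      antipodeSum (α + a) (P.shift a) (y ++ [b]) - antipodeSum α (P.shift b) (a :: y) := by
  have h1 : antipodeSum (α + a) (P.shift a) (y ++ [b]) =
      (∑ k ∈ Finset.range (y.length + 1), (α + a + weight (y.take k)) *
        ((-1) ^ (y.length + 1 + k) *
          shuffleCoeff (y.take k) (b :: (y.drop k).reverse) (P.shift a))) +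
      (α + a + weight (y ++ [b])) * P (a :: (y ++ [b])) := by
    rw [antipodeSum, List.length_append, List.length_singleton, Finset.sum_range_succ]
    congr 1
    · refine Finset.sum_congr rfl fun k hk => ?_
      have hk : k ≤ y.length := by simpa [Nat.lt_succ_iff] using hk
      rw [List.take_append_of_le_length hk, List.drop_append_of_le_length hk]
      simp
    · have e : y.length + 1 = (y ++ [b]).length := by simp
      rw [e, List.take_length, List.drop_length, List.reverse_nil, shuffleCoeff_nil_right,
        Even.neg_one_pow ⟨_, rfl⟩, one_mul]
      rfl
  have h2 : antipodeSum α (P.shift b) (a :: y) =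
      (∑ k ∈ Finset.range (y.length + 1), (α + a + weight (y.take k)) *
        ((-1) ^ (y.length + 1 + (k + 1)) *
          shuffleCoeff (a :: y.take k) (y.drop k).reverse (P.shift b))) +
      α * ((-1) ^ (y.length + 1) * P (b :: (y.reverse ++ [a]))) := by
    rw [antipodeSum, List.length_cons, Finset.sum_range_succ']
    congr 1
    · refine Finset.sum_congr rfl fun k hk => ?_
      rw [List.take_succ_cons, List.drop_succ_cons, weight_cons]
      push_cast
      ring
    · simp [weight_nil, shuffleCoeff_nil_left, shift_apply]
  have h3 : antipodeSum α P (a :: (y ++ [b])) =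
      (∑ k ∈ Finset.range (y.length + 1), (α + a + weight (y.take k)) *
        ((-1) ^ (y.length + 2 + (k + 1)) *
          (shuffleCoeff (y.take k) (b :: (y.drop k).reverse) (P.shift a) +
          shuffleCoeff (a :: y.take k) (y.drop k).reverse (P.shift b)))) +
      (α + a + weight (y ++ [b])) * P (a :: (y ++ [b])) +
      α * ((-1) ^ (y.length + 2) * P (b :: (y.reverse ++ [a]))) := by
    rw [antipodeSum, List.length_cons, List.length_append, List.length_singleton,
      Finset.sum_range_succ', Finset.sum_range_succ]
    congr 1
    · congr 1
      · refine Finset.sum_congr rfl fun k hk => ?_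
        have hk : k ≤ y.length := by simpa [Nat.lt_succ_iff] using hk
        rw [List.take_succ_cons, List.drop_succ_cons, List.take_append_of_le_length hk,
          List.drop_append_of_le_length hk, weight_cons, List.reverse_append,
          List.reverse_singleton, List.singleton_append, shuffleCoeff_cons_cons]
        push_cast
        ring
      · have e : y.length + 1 = (y ++ [b]).length := by simp
        rw [List.take_succ_cons, List.drop_succ_cons, e, List.take_length, List.drop_length,
          List.reverse_nil, shuffleCoeff_nil_right, Even.neg_one_pow ⟨_, rfl⟩, one_mul,
          weight_cons]
        push_cast
        ring
    · simp [weight_nil, shuffleCoeff_nil_left]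
  rw [h1, h2, h3]
  simp only [mul_add, Finset.sum_add_distrib, pow_add, pow_succ, mul_neg, neg_mul,
    mul_one, Finset.sum_neg_distrib, neg_neg]
  ring

theorem antipodeSum_eq_dynkin (x : List ℕ+) (hx : x ≠ []) :
    ∀ (α : ℂ) (P : Series), antipodeSum α P x = dynkin P x := by
  induction hn : x.length using Nat.strong_induction_on generalizing x with
  | _ n ih =>
    intro α P
    obtain ⟨a, t, rfl⟩ := List.exists_cons_of_ne_nil hx
    rcases List.eq_nil_or_concat' t with rfl | ⟨y, b, rfl⟩
    · rw [antipodeSum_singleton, dynkin_singleton]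
    · rw [antipodeSum_cons, dynkin_cons P a b (y ++ [b]) (a :: y) (by simp) (by simp),
        ih _ (by rw [← hn]; simp) (y ++ [b]) (by simp) rfl,
        ih _ (by rw [← hn]; simp) (a :: y) (by simp) rfl]

/-- With `α = 0` the empty prefix has factor zero, and proper nonempty prefixes give shuffles of
nonempty words, which `P` kills. Only the full prefix survives, with factor the weight of `x`. -/
theorem IsPrimitive.dynkin_eq {P : Series} (hP : IsPrimitive P) (x : List ℕ+) (hx : x ≠ []) :
    dynkin P x = weight x * P x := by
  rw [← antipodeSum_eq_dynkin x hx 0, antipodeSum, Finset.sum_range_succ,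
    Finset.sum_eq_zero, zero_add]
  · rw [List.take_length, List.drop_length, List.reverse_nil, shuffleCoeff_nil_right,
      Even.neg_one_pow ⟨_, rfl⟩, one_mul, zero_add]
  · intro j hj
    rw [Finset.mem_range] at hj
    rcases Nat.eq_zero_or_pos j with rfl | hj0
    · simp [weight_nil]
    · rw [hP.2, mul_zero, mul_zero]
      · simpa using ⟨by omega, hx⟩
      · simpa using hj

/-- A homogeneous primitive series is a combination of iterated commutators. -/
theorem IsPrimitive.eq_sum_nestedBracket {P : Series} (hP : IsPrimitive P) {n : ℕ} (hn : 0 < n)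
    (hom : IsHomogeneous n P) :
    P = ∑ w ∈ words n, (lastLetter w * P w / n) • nestedBracket w := by
  refine ext_apply fun x => ?_
  rw [Series.sum_apply]
  simp only [smul_apply]
  by_cases hx : weight x = n
  · have hx0 : x ≠ [] := by
      rintro rfl
      rw [weight_nil] at hx
      omega
    have h := hP.dynkin_eq x hx0
    have hn' : (n : ℂ) ≠ 0 := Nat.cast_ne_zero.mpr hn.ne'
    rw [dynkin, hx] at h
    rw [eq_comm, ← mul_right_inj' hn', ← h, Finset.mul_sum]
    refine Finset.sum_congr rfl fun w _ => ?_
    field_simp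
  · rw [hom x hx, Finset.sum_eq_zero]
    intro w hw
    rw [isHomogeneous_nestedBracket w x (by rw [mem_words.mp hw]; exact hx), mul_zero]

end Series

end CenterProblem

/-! ### The weight filtration and density of the group generated by exponentials of letters. -/

namespace CenterProblem

open Series SeriesGroup

namespace Series

/-- All coefficients at words of weight less than `n` vanish. -/
def VanishesBelow (n : ℕ) (f : Series) : Prop := ∀ w, weight w < n → f w = 0

theorem VanishesBelow.mono {m n : ℕ} {f : Series} (hf : VanishesBelow n f) (h : m ≤ n) :
    VanishesBelow m f := fun w hw => hf w (hw.trans_le h)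

theorem VanishesBelow.add {n : ℕ} {f g : Series} (hf : VanishesBelow n f)
    (hg : VanishesBelow n g) : VanishesBelow n (f + g) := fun w hw => by
  rw [add_apply, hf w hw, hg w hw, add_zero]

theorem VanishesBelow.sub {n : ℕ} {f g : Series} (hf : VanishesBelow n f)
    (hg : VanishesBelow n g) : VanishesBelow n (f - g) := fun w hw => by
  rw [sub_apply, hf w hw, hg w hw, sub_zero]

theorem VanishesBelow.mul {m n : ℕ} {f g : Series} (hf : VanishesBelow m f)
    (hg : VanishesBelow n g) : VanishesBelow (m + n) (f * g) := by
  intro w hw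
  refine Finset.sum_eq_zero fun j _ => ?_
  have := weight_take_add_drop j w
  by_cases h : weight (w.take j) < m
  · rw [hf _ h, zero_mul]
  · rw [hg _ (by omega), mul_zero]

theorem VanishesBelow.mul_left {n : ℕ} {g : Series} (hg : VanishesBelow n g) (f : Series) :
    VanishesBelow n (f * g) := by
  have h : VanishesBelow 0 f := fun w hw => absurd hw (Nat.not_lt_zero _)
  simpa using h.mul hg

theorem VanishesBelow.mul_right {n : ℕ} {f : Series} (hf : VanishesBelow n f) (g : Series) :
    VanishesBelow n (f * g) := by
  have h : VanishesBelow 0 g := fun w hw => absurd hw (Nat.not_lt_zero _)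
  simpa using hf.mul h

theorem IsHomogeneous.vanishesBelow {n : ℕ} {f : Series} (hf : IsHomogeneous n f) :
    VanishesBelow n f := fun w hw => hf w hw.ne

/-- The component of weight `n`. -/
noncomputable def component (n : ℕ) (f : Series) : Series := fun w => if weight w = n then f w else 0

theorem component_apply (n : ℕ) (f : Series) (w : List ℕ+) :
    component n f w = if weight w = n then f w else 0 := rfl

theorem isHomogeneous_component (n : ℕ) (f : Series) : IsHomogeneous n (component n f) :=
  fun _ hw => if_neg hw

theorem vanishesBelow_one_sub {f : Series} (hf : f [] = 1) : VanishesBelow 1 (f - 1) := by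
  intro w hw
  obtain rfl : w = [] := weight_eq_zero.mp (by omega)
  rw [sub_apply, hf, one_nil, sub_self]

theorem apply_of_vanishesBelow_sub {n : ℕ} {f g : Series} (h : VanishesBelow n (f - g))
    {w : List ℕ+} (hw : weight w < n) : f w = g w :=
  sub_eq_zero.mp (h w hw)

theorem vanishesBelow_sub_component {n : ℕ} {f : Series} (hn : 0 < n)
    (h : VanishesBelow n (f - 1)) : VanishesBelow (n + 1) (f - (1 + component n f)) := by
  intro w hw
  rw [sub_apply, add_apply, component_apply]
  split_ifs with hwn
  · match w with
    | [] => rw [weight_nil] at hwn; omega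
    | i :: w => rw [one_cons, zero_add, sub_self]
  · rw [add_zero, ← sub_apply]
    exact h w (by omega)

/-- On a shuffle of nonempty words of total weight `n` the series takes the value `f u * f v`, and
`f u = 0` because `u` is nonempty of weight below `n`. -/
theorem IsGroupLike.isPrimitive_component {f : Series} (hf : IsGroupLike f) {n : ℕ} (hn : 0 < n)
    (h : VanishesBelow n (f - 1)) : IsPrimitive (component n f) := by
  refine ⟨if_neg (by rw [weight_nil]; omega), fun u v hu hv => ?_⟩
  have hw : ∀ w : List ℕ+, w.Perm (u ++ v) → weight w = weight u + weight v := fun w hw => by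
    rw [weight_perm hw, weight_append]
  by_cases huv : weight u + weight v = n
  · rw [shuffleCoeff_congr (F := component n f) (G := f) fun w hw' => if_pos ((hw w hw').trans huv), hf,
      apply_of_vanishesBelow_sub h (show weight u < n by have := weight_pos hv; omega)]
    obtain ⟨i, u, rfl⟩ := List.exists_cons_of_ne_nil hu
    rw [one_cons, zero_mul]
  · rw [shuffleCoeff_congr (F := component n f) (G := 0) fun w hw' => if_neg (by rw [hw w hw']; exact huv), map_zero]

/-- All words in the support have letters in `A`. -/
def SupportedOn (A : Set ℕ+) (f : Series) : Prop := ∀ w, (∃ i ∈ w, i ∉ A) → f w = 0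

theorem SupportedOn.mul {A : Set ℕ+} {f g : Series} (hf : SupportedOn A f)
    (hg : SupportedOn A g) : SupportedOn A (f * g) := by
  rintro w ⟨i, hi, hA⟩
  refine Finset.sum_eq_zero fun j _ => ?_
  rw [← List.take_append_drop j w, List.mem_append] at hi
  rcases hi with hi | hi
  · rw [hf _ ⟨i, hi, hA⟩, zero_mul]
  · rw [hg _ ⟨i, hi, hA⟩, mul_zero]

theorem supportedOn_one (A : Set ℕ+) : SupportedOn A 1 := by
  rintro w ⟨i, hi, -⟩
  match w, hi with
  | j :: w, _ => exact one_cons j w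

theorem SupportedOn.sub {A : Set ℕ+} {f g : Series} (hf : SupportedOn A f)
    (hg : SupportedOn A g) : SupportedOn A (f - g) := fun w hw => by
  rw [sub_apply, hf w hw, hg w hw, sub_zero]

theorem SupportedOn.smul {A : Set ℕ+} {f : Series} (hf : SupportedOn A f) (c : ℂ) :
    SupportedOn A (c • f) := fun w hw => by rw [smul_apply, hf w hw, mul_zero]

theorem SupportedOn.pow {A : Set ℕ+} {f : Series} (hf : SupportedOn A f) (n : ℕ) :
    SupportedOn A (f ^ n) := by
  induction n with
  | zero => rw [pow_zero]; exact supportedOn_one A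
  | succ n ih => rw [pow_succ]; exact ih.mul hf

theorem supportedOn_X {A : Set ℕ+} {i : ℕ+} (hi : i ∈ A) : SupportedOn A (X i) := by
  rintro w ⟨j, hj, hA⟩
  refine if_neg ?_
  rintro rfl
  rw [List.mem_singleton] at hj
  exact hA (hj ▸ hi)

theorem supportedOn_nestedBracket {A : Set ℕ+} (w : List ℕ+) (hw : ∀ i ∈ w, i ∈ A) :
    SupportedOn A (nestedBracket w) := by
  match w with
  | [] => exact fun _ _ => rfl
  | [i] => exact supportedOn_X (hw i (by simp))
  | i :: j :: w =>
    have ih := supportedOn_nestedBracket (j :: w) fun k hk => hw k (List.mem_cons_of_mem _ hk)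
    have hX := supportedOn_X (hw i (by simp))
    rw [nestedBracket, Ring.lie_def]
    exact (hX.mul ih).sub (ih.mul hX)

end Series

namespace SeriesGroup

/-- The second and higher powers of `f` start in weight `2 * n`, hence above `n`. -/
theorem vanishesBelow_exp {n : ℕ} (hn : 0 < n) {f : Series} (hf : IsHomogeneous n f) :
    VanishesBelow (n + 1) ((exp f).1 - (1 + f)) := by
  have h0 : f [] = 0 := hf [] (by rw [weight_nil]; omega)
  have hp : ∀ k, VanishesBelow ((k + 2) * n) (f ^ (k + 2)) := by
    intro k
    induction k with
    | zero =>
      rw [zero_add, pow_two, two_mul]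
      exact hf.vanishesBelow.mul hf.vanishesBelow
    | succ k ih =>
      have h := ih.mul hf.vanishesBelow
      rw [← pow_succ] at h
      exact h.mono (by ring_nf; omega)
  intro w hw
  rw [sub_apply, exp_apply h0 (N := w.length + 2) (by omega), Finset.sum_range_succ',
    Finset.sum_range_succ', Finset.sum_eq_zero]
  · simp [add_apply]; ring
  · intro k _
    rw [hp k w (by nlinarith), zero_div]

theorem supportedOn_exp {A : Set ℕ+} {f : Series} (hf : SupportedOn A f) :
    SupportedOn A (exp f).1 := by
  intro w hw
  change ∑ n ∈ Finset.range (w.length + 1), (f ^ n) w / (n.factorial : ℂ) = 0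
  exact Finset.sum_eq_zero fun n _ => by rw [hf.pow n w hw, zero_div]

/-- The group of series supported on words with letters in `A`. -/
def supported (A : Set ℕ+) : Subgroup SeriesGroup where
  carrier := {g | SupportedOn A g.1}
  one_mem' := supportedOn_one A
  mul_mem' hf hg := SupportedOn.mul hf hg
  inv_mem' {g} hg := by
    have key : ∀ (n : ℕ) (w : List ℕ+), w.length = n → (∃ i ∈ w, i ∉ A) → (g⁻¹).1 w = 0 := by
      intro n
      induction n using Nat.strong_induction_on with
      | _ n ih =>
        rintro w hn ⟨i, hi, hA⟩
        have e := supportedOn_one A w ⟨i, hi, hA⟩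
        rw [← coe_inv_mul g, mul_apply, Finset.sum_range_succ, Finset.sum_eq_zero] at e
        · simpa [g.2] using e
        · intro j hj
          rw [Finset.mem_range] at hj
          rw [← List.take_append_drop j w, List.mem_append] at hi
          rcases hi with hi | hi
          · rw [ih (w.take j).length (by simp; omega) _ rfl ⟨i, hi, hA⟩, zero_mul]
          · rw [hg _ ⟨i, hi, hA⟩, mul_zero]
    exact fun w hw => key _ w rfl hw

theorem mem_supported {A : Set ℕ+} {g : SeriesGroup} : g ∈ supported A ↔ SupportedOn A g.1 :=
  Iff.rfl

theorem isClosed_supported (A : Set ℕ+) : IsClosed (supported A : Set SeriesGroup) := by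
  have : (supported A : Set SeriesGroup) =
      ⋂ w, ⋂ (_ : ∃ i ∈ w, i ∉ A), {g | g.1 w = 0} := by
    ext g; simp [mem_supported, SupportedOn]
  rw [this]
  exact isClosed_iInter fun w => isClosed_iInter fun _ => isClosed_eq (continuous_coeff w)
    continuous_const

/-- The group of group-like series in the variables `X₁`, `X₂`. -/
def abelGroupLike : Subgroup SeriesGroup := groupLike ⊓ supported {1, 2}

theorem isClosed_abelGroupLike : IsClosed (abelGroupLike : Set SeriesGroup) :=
  isClosed_groupLike.inter (isClosed_supported _)

theorem tendsto_of_coeff {ι : Type*} {l : Filter ι} {F : ι → SeriesGroup} {g : SeriesGroup}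
    (h : ∀ w, Filter.Tendsto (fun i => (F i).1 w) l (nhds (g.1 w))) :
    Filter.Tendsto F l (nhds g) :=
  tendsto_subtype_rng.mpr (tendsto_pi_nhds (A := fun _ : List ℕ+ => ℂ) |>.mpr h)

/-- Successive approximation in the weight filtration. -/
theorem subset_closure_of_approx (K : Subgroup SeriesGroup) (S : Set SeriesGroup)
    (hstab : ∀ k ∈ K, ∀ g ∈ S, k⁻¹ * g ∈ S)
    (happ : ∀ n, 0 < n → ∀ g ∈ S, VanishesBelow n (g.1 - 1) →
      ∃ k ∈ K, VanishesBelow (n + 1) (k.1 - g.1)) :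
    S ⊆ closure (K : Set SeriesGroup) := by
  intro g hg
  have key : ∀ n, ∃ k ∈ K, VanishesBelow (n + 1) ((k⁻¹ * g).1 - 1) := by
    intro n
    induction n with
    | zero => exact ⟨1, K.one_mem, vanishesBelow_one_sub (1⁻¹ * g : SeriesGroup).2⟩
    | succ n ih =>
      obtain ⟨k, hk, h⟩ := ih
      obtain ⟨l, hl, h'⟩ := happ (n + 1) n.succ_pos _ (hstab k hk g hg) h
      refine ⟨k * l, K.mul_mem hk hl, ?_⟩
      -- The remainder `k⁻¹ * g` is itself approximated by `l` one weight further, and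
      -- multiplication by `l⁻¹` preserves the filtration.
      have e : ((k * l)⁻¹ * g).1 - 1 = -((l⁻¹).1 * (l.1 - (k⁻¹ * g).1)) := by
        rw [mul_sub, coe_inv_mul, mul_inv_rev, mul_assoc, coe_mul l⁻¹]
        abel
      rw [e]
      intro w hw
      rw [neg_apply, h'.mul_left _ w hw, neg_zero]
  choose k hk hkn using key
  refine mem_closure_of_tendsto (f := k) (b := Filter.atTop) (tendsto_of_coeff fun w => ?_)
    (Filter.Eventually.of_forall hk)
  refine tendsto_const_nhds.congr' ?_
  filter_upwards [Filter.eventually_ge_atTop (weight w)] with n hn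
  have e : g.1 - (k n).1 = (k n).1 * (((k n)⁻¹ * g).1 - 1) := by
    rw [mul_sub, ← coe_mul, mul_inv_cancel_left, mul_one]
  refine apply_of_vanishesBelow_sub (n := n + 1) ?_ (Nat.lt_succ_of_le hn)
  rw [e]
  exact (hkn n).mul_left _

/-- Products of elements `1 + P_w + ⋯` have the form `1 + ∑ P_w + ⋯`. -/
theorem exists_mem_sum {ι : Type*} (K : Subgroup SeriesGroup) {n : ℕ} (hn : 0 < n) (s : Finset ι)
    (P : ι → Series) (hP : ∀ i ∈ s, IsHomogeneous n (P i))
    (h : ∀ i ∈ s, ∃ k ∈ K, VanishesBelow (n + 1) (k.1 - (1 + P i))) :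
    ∃ k ∈ K, VanishesBelow (n + 1) (k.1 - (1 + ∑ i ∈ s, P i)) := by
  classical
  induction s using Finset.induction_on with
  | empty =>
    refine ⟨1, K.one_mem, fun w _ => ?_⟩
    rw [Finset.sum_empty, add_zero, coe_one, sub_self]; rfl
  | insert i s hi ih =>
    obtain ⟨k, hk, hk'⟩ := h i (Finset.mem_insert_self i s)
    obtain ⟨l, hl, hl'⟩ := ih (fun j hj => hP j (Finset.mem_insert_of_mem hj))
      (fun j hj => h j (Finset.mem_insert_of_mem hj))
    refine ⟨k * l, K.mul_mem hk hl, ?_⟩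
    have hPi := (hP i (Finset.mem_insert_self i s)).vanishesBelow
    have hS : VanishesBelow n (∑ j ∈ s, P j) := fun w hw => by
      rw [Series.sum_apply]
      exact Finset.sum_eq_zero fun j hj =>
        (hP j (Finset.mem_insert_of_mem hj)).vanishesBelow w hw
    rw [Finset.sum_insert hi, coe_mul]
    have e : k.1 * l.1 - (1 + (P i + ∑ j ∈ s, P j)) =
        (k.1 - (1 + P i)) * l.1 + (1 + P i) * (l.1 - (1 + ∑ j ∈ s, P j)) +
          P i * ∑ j ∈ s, P j := by noncomm_ring
    rw [e]
    exact ((hk'.mul_right _).add (hl'.mul_left _)).add ((hPi.mul hS).mono (by omega))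

/-- The group generated by the exponentials of multiples of `X₁` and `X₂`. -/
def generated (A : Set ℕ+) : Subgroup SeriesGroup :=
  Subgroup.closure {g | ∃ (c : ℂ) (i : ℕ+), i ∈ A ∧ g = exp (c • X i)}

theorem generated_le (A : Set ℕ+) : generated A ≤ groupLike ⊓ supported A := by
  rw [generated, Subgroup.closure_le]
  rintro g ⟨c, i, hi, rfl⟩
  exact ⟨isGroupLike_exp ((isPrimitive_X i).smul c), supportedOn_exp ((supportedOn_X hi).smul c)⟩

/-- The group commutator of `1 + P + ⋯` and `1 + Q + ⋯` is `1 + [P, Q] + ⋯`, so brackets are reached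
by induction on the word. -/
theorem exists_mem_generated {A : Set ℕ+} (w : List ℕ+) (hw0 : w ≠ []) (hw : ∀ i ∈ w, i ∈ A)
    (c : ℂ) : ∃ k ∈ generated A,
      VanishesBelow (weight w + 1) (k.1 - (1 + c • nestedBracket w)) := by
  match w with
  | [i] =>
    refine ⟨_, Subgroup.subset_closure ⟨c, i, hw i (by simp), rfl⟩, ?_⟩
    have h := vanishesBelow_exp i.pos ((isHomogeneous_X i).smul c)
    simpa [weight, nestedBracket] using h
  | i :: j :: w =>
    obtain ⟨g, hg, hg'⟩ := exists_mem_generated (j :: w) (by simp)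
      (fun k hk => hw k (List.mem_cons_of_mem _ hk)) c
    have hf : exp ((1 : ℂ) • X i) ∈ generated A :=
      Subgroup.subset_closure ⟨1, i, hw i (by simp), rfl⟩
    have hf' := vanishesBelow_exp i.pos ((isHomogeneous_X i).smul 1)
    rw [one_smul] at hf hf'
    set f := exp (X i)
    set Q := nestedBracket (j :: w) with hQ
    have hQh : IsHomogeneous (weight (j :: w)) Q := isHomogeneous_nestedBracket _
    set n := weight (j :: w)
    have hfX : VanishesBelow i (X i) := (isHomogeneous_X i).vanishesBelow
    have hcQ : VanishesBelow n (c • Q) := (hQh.smul c).vanishesBelow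
    refine ⟨f * g * f⁻¹ * g⁻¹, mul_mem (mul_mem (mul_mem hf hg) (inv_mem hf)) (inv_mem hg), ?_⟩
    have hg1 : VanishesBelow n (g.1 - 1) := by
      have e : g.1 - 1 = (g.1 - (1 + c • Q)) + c • Q := by abel
      rw [e]
      exact (hg'.mono (Nat.le_succ _)).add hcQ
    have hlie : VanishesBelow (i + n + 1) ((f.1 * g.1 - g.1 * f.1) - (X i * (c • Q) - (c • Q) * X i)) := by
      have e : (f.1 * g.1 - g.1 * f.1) - (X i * (c • Q) - (c • Q) * X i) =
          ((f.1 - (1 + X i)) * (g.1 - 1) - (g.1 - 1) * (f.1 - (1 + X i))) +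
          (X i * (g.1 - (1 + c • Q)) - (g.1 - (1 + c • Q)) * X i) := by noncomm_ring
      rw [e]
      exact (((hf'.mul hg1).mono (by omega)).sub ((hg1.mul hf').mono (by omega))).add
        (((hfX.mul hg').mono (by omega)).sub ((hg'.mul hfX).mono (by omega)))
    have hB : VanishesBelow (i + n) (X i * (c • Q) - (c • Q) * X i) :=
      (hfX.mul hcQ).sub ((hcQ.mul hfX).mono (by omega))
    have hinv : VanishesBelow 1 ((f⁻¹ * g⁻¹).1 - 1) := vanishesBelow_one_sub (f⁻¹ * g⁻¹).2
    -- Since `f⁻¹ * g⁻¹` inverts `g * f` and has constant term `1`, the leading term is that of the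
    -- ring commutator of `f` and `g`.
    have e1 : (f * g * f⁻¹ * g⁻¹).1 = 1 + (f.1 * g.1 - g.1 * f.1) * (f⁻¹ * g⁻¹).1 := by
      rw [sub_mul, ← coe_mul, ← coe_mul, ← coe_mul, ← coe_mul]
      have : g * f * (f⁻¹ * g⁻¹) = 1 := by group
      rw [this, coe_one, mul_assoc (f * g)]
      abel
    have e2 : c • nestedBracket (i :: j :: w) = X i * (c • Q) - (c • Q) * X i := by
      rw [nestedBracket, Ring.lie_def, smul_sub, mul_smul_series, smul_mul_series]
    rw [e1, e2, weight_cons]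
    have e3 : 1 + (f.1 * g.1 - g.1 * f.1) * (f⁻¹ * g⁻¹).1 - (1 + (X i * (c • Q) - (c • Q) * X i)) =
        ((f.1 * g.1 - g.1 * f.1) - (X i * (c • Q) - (c • Q) * X i)) * (f⁻¹ * g⁻¹).1 +
        (X i * (c • Q) - (c • Q) * X i) * ((f⁻¹ * g⁻¹).1 - 1) := by noncomm_ring
    rw [e3]
    exact (hlie.mul_right _).add (hB.mul hinv)

/-- The Dynkin formula uses the coefficients of the component itself as weights, so words with a
letter outside `A` drop out. -/
theorem subset_closure_generated (A : Set ℕ+) :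
    ((groupLike ⊓ supported A : Subgroup SeriesGroup) : Set SeriesGroup) ⊆
      closure (generated A : Set SeriesGroup) := by
  refine subset_closure_of_approx _ _
    (fun k hk g hg => mul_mem (inv_mem (generated_le A hk)) hg) fun n hn g hg hgn => ?_
  set P := component n g.1 with hP
  have hprim := IsGroupLike.isPrimitive_component hg.1 hn hgn
  have hsum := hprim.eq_sum_nestedBracket hn (isHomogeneous_component n g.1)
  obtain ⟨k, hk, hk'⟩ := exists_mem_sum (generated A) hn (words n)
    (fun w => (lastLetter w * P w / n) • nestedBracket w)
    (fun w hw => mem_words.mp hw ▸ (isHomogeneous_nestedBracket w).smul _) (by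
      intro w hw
      rw [mem_words] at hw
      by_cases hwA : ∃ i ∈ w, i ∉ A
      · refine ⟨1, one_mem _, fun v _ => ?_⟩
        have : P w = 0 := by
          rw [hP, component_apply, hg.2 w hwA, ite_self]
        rw [this, mul_zero, zero_div, zero_smul, add_zero, coe_one, sub_self]; rfl
      · rw [← hw]
        refine exists_mem_generated w ?_ ?_ _
        · rintro rfl
          rw [weight_nil] at hw
          omega
        · intro i hi
          by_contra h
          exact hwA ⟨i, hi, h⟩)
  rw [← hsum] at hk'
  refine ⟨k, hk, ?_⟩
  have e : k.1 - g.1 = (k.1 - (1 + P)) - (g.1 - (1 + P)) := by abel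
  rw [e]
  exact hk'.sub (vanishesBelow_sub_component hn hgn)

end SeriesGroup

end CenterProblem

/-! ### Iterated integrals, and formal paths as group-like series. -/

namespace CenterProblem

open Series SeriesGroup MeasureTheory

namespace Series

/-- The series with the given coefficients. -/
def ofCoeff (f : List ℕ+ → ℂ) : Series := f

theorem ofCoeff_apply (f : List ℕ+ → ℂ) (w : List ℕ+) : ofCoeff f w = f w := rfl

theorem smul_X_pow_apply (z : ℂ) (i : ℕ+) (n : ℕ) (w : List ℕ+) :
    ((z • X i) ^ n) w = if w = List.replicate n i then z ^ n else 0 := by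
  induction n generalizing w with
  | zero => rw [pow_zero, pow_zero]; rfl
  | succ n ih =>
    rw [pow_succ', smul_mul_series, smul_apply]
    match w with
    | [] => simp [mul_nil, X]
    | j :: w =>
      rw [X_mul_cons, ih, List.replicate_succ]
      by_cases hj : j = i
      · by_cases hw : w = List.replicate n i
        · simp [hj, hw, pow_succ']
        · simp [hw]
      · simp [hj]

end Series

namespace SeriesGroup

theorem exp_smul_X_apply (z : ℂ) (i : ℕ+) (w : List ℕ+) :
    (exp (z • X i)).1 w =
      if w = List.replicate w.length i then z ^ w.length / (w.length.factorial : ℂ) else 0 := by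
  change ∑ n ∈ Finset.range (w.length + 1), ((z • X i) ^ n) w / (n.factorial : ℂ) = _
  rw [Finset.sum_range_succ, Finset.sum_eq_zero, zero_add, smul_X_pow_apply]
  · split_ifs
    · rfl
    · rw [zero_div]
  · intro n hn
    rw [smul_X_pow_apply, if_neg, zero_div]
    intro h
    have := congrArg List.length h
    rw [List.length_replicate] at this
    rw [Finset.mem_range] at hn
    omega

theorem exp_zero : exp 0 = 1 := by
  have h : exp 0 = exp ((0 : ℂ) • X 1) := by rw [zero_smul]
  rw [h]
  refine ext_apply fun w => ?_
  rw [exp_smul_X_apply]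
  match w with
  | [] => simp [coe_one, one_nil]
  | i :: w => simp [coe_one, one_cons]

/-- The equation `d/dz exp(z X_i) = X_i exp(z X_i)`, read coefficientwise. -/
theorem hasDerivAt_exp_smul_X (i j : ℕ+) (w : List ℕ+) (z : ℂ) :
    HasDerivAt (fun z : ℂ => (exp (z • X i)).1 (j :: w))
      (if j = i then (exp (z • X i)).1 w else 0) z := by
  have hfun : (fun z : ℂ => (exp (z • X i)).1 (j :: w)) = fun z : ℂ =>
      (if j = i then (if w = List.replicate w.length i then
        1 / ((w.length + 1).factorial : ℂ) else 0) else 0) * z ^ (w.length + 1) := by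
    funext z
    rw [exp_smul_X_apply]
    by_cases hj : j = i
    · by_cases hw : w = List.replicate w.length i
      · rw [if_pos (by rw [List.length_cons, List.replicate_succ, ← hw, hj]), if_pos hj, if_pos hw,
          List.length_cons]
        ring
      · rw [if_neg (fun h : j :: w = List.replicate (j :: w).length i => hw (List.cons.inj h).2),
          if_pos hj, if_neg hw, zero_mul]
    · rw [if_neg (fun h : j :: w = List.replicate (j :: w).length i => hj (List.cons.inj h).1), if_neg hj, zero_mul]
  rw [hfun]
  refine ((hasDerivAt_pow (w.length + 1) z).const_mul _).congr_deriv ?_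
  rw [exp_smul_X_apply]
  by_cases hj : j = i
  · rw [if_pos hj, if_pos hj]
    split_ifs
    · rw [Nat.factorial_succ]
      have : (w.length.factorial : ℂ) ≠ 0 := Nat.cast_ne_zero.mpr (Nat.factorial_ne_zero _)
      have h' : (w.length : ℂ) + 1 ≠ 0 := Nat.cast_add_one_ne_zero _
      push_cast
      field_simp
    · rw [zero_mul]
  · rw [if_neg hj, if_neg hj, zero_mul]

theorem hasDerivAt_exp_smul_X_mul (i j : ℕ+) (w : List ℕ+) (F : Series) (z : ℂ) :
    HasDerivAt (fun z : ℂ => ((exp (z • X i)).1 * F) (j :: w))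
      (if j = i then ((exp (z • X i)).1 * F) w else 0) z := by
  have h : ∀ z : ℂ, ((exp (z • X i)).1 * F) (j :: w) = F (j :: w) +
      ∑ k ∈ Finset.range (w.length + 1),
        (exp (z • X i)).1 (j :: w.take k) * F (w.drop k) := by
    intro z
    rw [mul_cons, (exp (z • X i)).2, one_mul]
    rfl
  simp only [h]
  refine ((HasDerivAt.fun_sum fun k _ =>
    (hasDerivAt_exp_smul_X i j (w.take k) z).mul_const (F (w.drop k))).const_add _).congr_deriv ?_
  split_ifs
  · rfl
  · simp

theorem exp_smul_X_mul_exp_neg (i : ℕ+) (c : ℂ) : exp (c • X i) * exp (-c • X i) = 1 := by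
  have key : ∀ (w : List ℕ+) (z : ℂ),
      ((exp (z • X i)).1 * (exp (-c • X i)).1) w = (exp ((z - c) • X i)).1 w := by
    intro w
    induction w with
    | nil => intro z; rw [mul_nil, (exp _).2, (exp _).2, (exp _).2, one_mul]
    | cons j w ih =>
      have hd : ∀ z : ℂ, HasDerivAt (fun z : ℂ => ((exp (z • X i)).1 * (exp (-c • X i)).1) (j :: w) -
          (exp ((z - c) • X i)).1 (j :: w)) 0 z := by
        intro z
        have h1 := hasDerivAt_exp_smul_X_mul i j w (exp (-c • X i)).1 z
        have h2 := (hasDerivAt_exp_smul_X i j w (z - c)).comp_sub_const z c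
        refine (h1.sub h2).congr_deriv ?_
        rw [ih, sub_self]
      intro z
      -- By the induction hypothesis for the shorter word the two sides have equal derivatives; they
      -- agree at `z = 0`. The lemma itself is the case `z = c`.
      have h := is_const_of_deriv_eq_zero (fun z => (hd z).differentiableAt)
        (fun z => (hd z).deriv) z 0
      rw [zero_smul, zero_sub, exp_zero, coe_one, one_mul, sub_self] at h
      exact sub_eq_zero.mp h
  refine ext_apply fun w => ?_
  rw [coe_mul, key, sub_self, zero_smul, exp_zero]

end SeriesGroup

section Picard

variable {T : ℝ} {a : ℕ+ → ℝ → ℂ}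

theorem intervalIntegrable_coeff (hT : 0 ≤ T) (ha : a ∈ coeffSpace T) (i : ℕ+) :
    IntervalIntegrable (a i) volume 0 T := by
  obtain ⟨hm, C, hC⟩ := ha
  rw [intervalIntegrable_iff_integrableOn_Icc_of_le hT]
  refine Measure.integrableOn_of_bounded (M := C ^ (i : ℕ)) (by simp)
    (hm i).aestronglyMeasurable ?_
  filter_upwards [ae_restrict_mem measurableSet_Icc] with x hx using hC i x hx

theorem continuousOn_picard (hT : 0 ≤ T) (ha : a ∈ coeffSpace T) (w : List ℕ+) :
    ContinuousOn (picard a w) (Set.Icc 0 T) := by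
  induction w with
  | nil => exact continuousOn_const
  | cons i w ih =>
    have h : IntervalIntegrable (fun s => a i s * picard a w s) volume 0 T :=
      (intervalIntegrable_coeff hT ha i).mul_continuousOn (by rwa [Set.uIcc_of_le hT])
    have h' := intervalIntegral.continuousOn_primitive_interval'
      (μ := volume) h (a := 0) (by simp)
    rwa [Set.uIcc_of_le hT] at h'

theorem intervalIntegrable_coeff_mul_picard (hT : 0 ≤ T) (ha : a ∈ coeffSpace T) (i : ℕ+)
    (w : List ℕ+) : IntervalIntegrable (fun s => a i s * picard a w s) volume 0 T :=
  (intervalIntegrable_coeff hT ha i).mul_continuousOn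
    (by rw [Set.uIcc_of_le hT]; exact continuousOn_picard hT ha w)

theorem exists_bound_coeff_mul_picard (hT : 0 ≤ T) (ha : a ∈ coeffSpace T) (i : ℕ+)
    (w : List ℕ+) : ∃ C, ∀ x ∈ Set.Icc 0 T, ‖a i x * picard a w x‖ ≤ C := by
  obtain ⟨D, hD⟩ := isCompact_Icc.exists_bound_of_continuousOn (continuousOn_picard hT ha w)
  obtain ⟨-, C, hC⟩ := ha
  refine ⟨C ^ (i : ℕ) * D, fun x hx => ?_⟩
  rw [norm_mul]
  exact mul_le_mul (hC i x hx) (hD x hx) (norm_nonneg _) ((norm_nonneg _).trans (hC i x hx))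

theorem lipschitzOnWith_primitive {f : ℝ → ℂ} (hT : 0 ≤ T) (hf : IntervalIntegrable f volume 0 T)
    {C : ℝ} (hC : ∀ x ∈ Set.Icc 0 T, ‖f x‖ ≤ C) :
    LipschitzOnWith C.toNNReal (fun x => ∫ s in (0 : ℝ)..x, f s) (Set.Icc 0 T) := by
  refine LipschitzOnWith.of_dist_le_mul fun x hx y hy => ?_
  have h0 : (0 : ℝ) ∈ Set.uIcc 0 T := by simp
  rw [← Set.uIcc_of_le hT] at hx hy
  have hsub : ∀ z ∈ Set.uIcc 0 T, IntervalIntegrable f volume 0 z := fun z hz =>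
    hf.mono_set (Set.uIcc_subset_uIcc h0 hz)
  rw [dist_eq_norm, intervalIntegral.integral_interval_sub_left (hsub x hx) (hsub y hy),
    Real.dist_eq]
  have hC0 : 0 ≤ C := (norm_nonneg _).trans (hC 0 ⟨le_rfl, hT⟩)
  rw [Real.coe_toNNReal C hC0]
  refine intervalIntegral.norm_integral_le_of_norm_le_const fun s hs => hC s ?_
  rw [← Set.uIcc_of_le hT]
  exact Set.uIcc_subset_uIcc hy hx (Set.uIoc_subset_uIcc hs)

/-- Integration by parts for primitives of bounded functions. -/
theorem primitive_mul_primitive {f g : ℝ → ℂ} (hT : 0 ≤ T) (hf : IntervalIntegrable f volume 0 T)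
    (hg : IntervalIntegrable g volume 0 T) {C : ℝ} (hfC : ∀ x ∈ Set.Icc 0 T, ‖f x‖ ≤ C) {D : ℝ}
    (hgD : ∀ x ∈ Set.Icc 0 T, ‖g x‖ ≤ D) {x : ℝ} (hx : x ∈ Set.Icc 0 T) :
    (∫ s in (0 : ℝ)..x, f s) * (∫ s in (0 : ℝ)..x, g s) =
      ∫ s in (0 : ℝ)..x, (f s * (∫ r in (0 : ℝ)..s, g r) + (∫ r in (0 : ℝ)..s, f r) * g s) := by
  have lf := lipschitzOnWith_primitive hT hf hfC
  have lg := lipschitzOnWith_primitive hT hg hgD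
  set F := fun x => ∫ s in (0 : ℝ)..x, f s with hF
  set G := fun x => ∫ s in (0 : ℝ)..x, g s with hG
  set h := fun s => f s * G s + F s * g s with hh
  have hci : IntervalIntegrable h volume 0 T :=
    (hf.mul_continuousOn (by rw [Set.uIcc_of_le hT]; exact lg.continuousOn)).add
      (hg.continuousOn_mul (by rw [Set.uIcc_of_le hT]; exact lf.continuousOn))
  obtain ⟨A, hA⟩ := isCompact_Icc.exists_bound_of_continuousOn lf.continuousOn
  obtain ⟨B, hB⟩ := isCompact_Icc.exists_bound_of_continuousOn lg.continuousOn
  have hhb : ∀ x ∈ Set.Icc 0 T, ‖h x‖ ≤ C * B + A * D := by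
    intro x hx
    refine (norm_add_le _ _).trans ?_
    rw [norm_mul, norm_mul]
    exact add_le_add
      (mul_le_mul (hfC x hx) (hB x hx) (norm_nonneg _) ((norm_nonneg _).trans (hfC x hx)))
      (mul_le_mul (hA x hx) (hgD x hx) (norm_nonneg _) ((norm_nonneg _).trans (hA x hx)))
  have lh := lipschitzOnWith_primitive hT hci hhb
  rw [← Set.uIcc_of_le hT] at lf lg lh
  -- The integrands are only bounded and integrable, so the product rule holds almost everywhere.
  -- Primitives of bounded functions are Lipschitz, hence absolutely continuous, and a zero
  -- derivative almost everywhere forces `F * G - ∫ h` to be constant.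
  have ac := (lf.absolutelyContinuousOnInterval.smul lg.absolutelyContinuousOnInterval).sub
    lh.absolutelyContinuousOnInterval
  obtain ⟨c, hc⟩ := ac.const_of_ae_hasDerivAt_zero (by
    filter_upwards [hf.ae_hasDerivAt_integral, hg.ae_hasDerivAt_integral,
      hci.ae_hasDerivAt_integral] with y h1 h2 h3 hy
    refine (((h1 hy 0 (by simp)).mul (h2 hy 0 (by simp))).sub (h3 hy 0 (by simp))).congr_deriv ?_
    exact sub_self _)
  have e0 := hc 0 (by simp)
  have e1 := hc x (by rwa [Set.uIcc_of_le hT])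
  rw [← e0] at e1
  change F x * G x - (∫ s in (0 : ℝ)..x, h s) = F 0 * G 0 - ∫ s in (0 : ℝ)..0, h s at e1
  have hF0 : F 0 = 0 := intervalIntegral.integral_same
  rw [hF0, zero_mul, intervalIntegral.integral_same, sub_zero] at e1
  exact sub_eq_zero.mp e1

/-- A shuffle coefficient is a finite sum of coefficients, so it commutes with coefficientwise
integration. -/
theorem shuffleCoeff_integral {x : ℝ} (u v : List ℕ+) (G : ℝ → Series)
    (hG : ∀ w, IntervalIntegrable (fun s => G s w) volume 0 x) :
    IntervalIntegrable (fun s => shuffleCoeff u v (G s)) volume 0 x ∧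
      shuffleCoeff u v (ofCoeff fun w => ∫ s in (0 : ℝ)..x, G s w) =
        ∫ s in (0 : ℝ)..x, shuffleCoeff u v (G s) := by
  match u, v with
  | [], v =>
    simp only [shuffleCoeff_nil_left]
    exact ⟨hG v, rfl⟩
  | i :: u, [] =>
    simp only [shuffleCoeff_nil_right]
    exact ⟨hG _, rfl⟩
  | i :: u, j :: v =>
    have h1 := shuffleCoeff_integral u (j :: v) (fun s => (G s).shift i) fun w => hG (i :: w)
    have h2 := shuffleCoeff_integral (i :: u) v (fun s => (G s).shift j) fun w => hG (j :: w)
    simp only [shuffleCoeff_cons_cons]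
    refine ⟨h1.1.add h2.1, ?_⟩
    rw [intervalIntegral.integral_add h1.1 h2.1, ← h1.2, ← h2.2]
    rfl
  termination_by u.length + v.length

/-- The recursion for shuffles is integration by parts: the product of two iterated integrals is
split according to which of the outermost variables is larger. -/
theorem shuffleCoeff_picard (hT : 0 ≤ T) (ha : a ∈ coeffSpace T) (u v : List ℕ+) {x : ℝ}
    (hx : x ∈ Set.Icc 0 T) :
    shuffleCoeff u v (ofCoeff fun w => picard a w x) = picard a u x * picard a v x := by
  have hshift : ∀ (i : ℕ+) (u v : List ℕ+), (∀ s ∈ Set.Icc 0 T,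
      shuffleCoeff u v (ofCoeff fun w => picard a w s) = picard a u s * picard a v s) →
      IntervalIntegrable (fun s => a i s * (picard a u s * picard a v s)) volume 0 x ∧
      shuffleCoeff u v ((ofCoeff fun w => picard a w x).shift i) =
        ∫ s in (0 : ℝ)..x, a i s * (picard a u s * picard a v s) := by
    intro i u v h
    have hsub : Set.uIcc 0 x ⊆ Set.uIcc 0 T := by
      rw [Set.uIcc_of_le hT, Set.uIcc_of_le hx.1]
      exact Set.Icc_subset_Icc_right hx.2
    have key := shuffleCoeff_integral (x := x) u v
      (fun s => a i s • (ofCoeff fun w => picard a w s)) fun w =>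
        (intervalIntegrable_coeff_mul_picard hT ha i w).mono_set hsub
    have hcongr : Set.EqOn
        (fun s => shuffleCoeff u v (a i s • (ofCoeff fun w => picard a w s)))
        (fun s => a i s * (picard a u s * picard a v s)) (Set.uIcc 0 x) := by
      intro s hs
      have hs' := hsub hs
      rw [Set.uIcc_of_le hT] at hs'
      change shuffleCoeff u v (a i s • (ofCoeff fun w => picard a w s)) = _
      rw [map_smul, h s hs', smul_eq_mul]
    exact ⟨key.1.congr fun s hs => hcongr (Set.uIoc_subset_uIcc hs),
      key.2.trans (intervalIntegral.integral_congr hcongr)⟩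
  match u, v with
  | [], v => rw [shuffleCoeff_nil_left, ofCoeff_apply, picard, one_mul]
  | i :: u, [] => rw [shuffleCoeff_nil_right, ofCoeff_apply]; simp [picard]
  | i :: u, j :: v =>
    obtain ⟨i1, e1⟩ := hshift i u (j :: v) fun s hs => shuffleCoeff_picard hT ha u (j :: v) hs
    obtain ⟨i2, e2⟩ := hshift j (i :: u) v fun s hs => shuffleCoeff_picard hT ha (i :: u) v hs
    obtain ⟨C, hC⟩ := exists_bound_coeff_mul_picard hT ha i u
    obtain ⟨D, hD⟩ := exists_bound_coeff_mul_picard hT ha j v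
    have parts := primitive_mul_primitive hT (intervalIntegrable_coeff_mul_picard hT ha i u)
      (intervalIntegrable_coeff_mul_picard hT ha j v) hC hD hx
    rw [shuffleCoeff_cons_cons, e1, e2, ← intervalIntegral.integral_add i1 i2]
    refine Eq.trans ?_ parts.symm
    congr 1
    funext s
    simp only [picard]
    ring
  termination_by u.length + v.length

theorem isGroupLike_monodromy (hT : 0 ≤ T) (ha : a ∈ coeffSpace T) :
    monodromy T a ∈ groupLike :=
  fun u v => shuffleCoeff_picard hT ha u v ⟨hT, le_rfl⟩

theorem picard_eq_zero {A : Set ℕ+} (ha : ∀ i ∉ A, ∀ x ∈ Set.Icc 0 T, a i x = 0) {w : List ℕ+}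
    (hw : ∃ i ∈ w, i ∉ A) {x : ℝ} (hx : x ∈ Set.Icc 0 T) : picard a w x = 0 := by
  induction w generalizing x with
  | nil => obtain ⟨i, hi, -⟩ := hw; simp at hi
  | cons j w ih =>
    have : Set.EqOn (fun s => a j s * picard a w s) (fun _ => 0) (Set.uIcc 0 x) := by
      intro s hs
      rw [Set.uIcc_of_le hx.1] at hs
      have hs' : s ∈ Set.Icc 0 T := ⟨hs.1, hs.2.trans hx.2⟩
      obtain ⟨i, hi, hA⟩ := hw
      change a j s * picard a w s = 0
      rcases List.mem_cons.mp hi with rfl | hi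
      · rw [ha i hA s hs', zero_mul]
      · rw [ih ⟨i, hi, hA⟩ hs', mul_zero]
    rw [picard, intervalIntegral.integral_congr this, intervalIntegral.integral_zero]

theorem picard_congr {b : ℕ+ → ℝ → ℂ} {τ : ℝ} (h : ∀ i, ∀ x ∈ Set.Icc 0 τ, a i x = b i x)
    (w : List ℕ+) {x : ℝ} (hx : x ∈ Set.Icc 0 τ) : picard a w x = picard b w x := by
  induction w generalizing x with
  | nil => rfl
  | cons j w ih =>
    refine intervalIntegral.integral_congr fun s hs => ?_
    rw [Set.uIcc_of_le hx.1] at hs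
    have hs' : s ∈ Set.Icc 0 τ := ⟨hs.1, hs.2.trans hx.2⟩
    change a j s * picard a w s = b j s * picard b w s
    rw [h j s hs', ih hs']

/-- Extending a path by a path in the direction of one of the variables. -/
theorem picard_extend (hT : 0 ≤ T) (ha : a ∈ coeffSpace T) {τ : ℝ} (hτ : τ ∈ Set.Icc 0 T)
    (i : ℕ+) (c : ℂ) (hac : ∀ j, ∀ x ∈ Set.Ioc τ T, a j x = if j = i then c else 0)
    (w : List ℕ+) {x : ℝ} (hx : x ∈ Set.Icc τ T) :
    picard a w x = ((exp ((c * (x - τ : ℝ)) • X i)).1 * (ofCoeff fun w => picard a w τ)) w := by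
  induction w generalizing x with
  | nil => rw [mul_nil, (exp _).2, one_mul]; rfl
  | cons j w ih =>
    set F := ofCoeff fun w => picard a w τ with hF
    have hint : ∀ y ∈ Set.Icc 0 T, ∀ z ∈ Set.Icc 0 T,
        IntervalIntegrable (fun s => a j s * picard a w s) volume y z := fun y hy z hz =>
      (intervalIntegrable_coeff_mul_picard hT ha j w).mono_set (by
        rw [← Set.uIcc_of_le hT] at hy hz
        exact Set.uIcc_subset_uIcc hy hz)
    have h0 : (0 : ℝ) ∈ Set.Icc 0 T := ⟨le_rfl, hT⟩
    have hxT : x ∈ Set.Icc 0 T := ⟨hτ.1.trans hx.1, hx.2⟩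
    have hd : ∀ s : ℝ, HasDerivAt
        (fun s : ℝ => ((exp ((c * (s - τ : ℝ)) • X i)).1 * F) (j :: w))
        ((if j = i then ((exp ((c * (s - τ : ℝ)) • X i)).1 * F) w else 0) * c) s := by
      intro s
      have h1 := hasDerivAt_exp_smul_X_mul i j w F (c * (s - τ : ℝ))
      have h2 : HasDerivAt (fun s : ℝ => c * ((s - τ : ℝ) : ℂ)) c s := by
        simpa using (((hasDerivAt_id s).sub_const τ).ofReal_comp).const_mul c
      exact h1.comp s h2
    have hcont : Continuous fun s : ℝ =>
        (if j = i then ((exp ((c * (s - τ : ℝ)) • X i)).1 * F) w else 0) * c := by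
      refine Continuous.mul ?_ continuous_const
      split_ifs
      · have hc : Continuous fun s : ℝ => c * ((s - τ : ℝ) : ℂ) := by fun_prop
        simp only [mul_apply]
        exact continuous_finsetSum _ fun k _ =>
          ((SeriesGroup.continuous_coeff _).comp (continuous_exp_smul hc (X i))).mul
            continuous_const
      · exact continuous_const
    have hftc := intervalIntegral.integral_eq_sub_of_hasDerivAt (a := τ) (b := x)
      (fun s _ => hd s) (hcont.intervalIntegrable _ _)
    have hcongr : ∫ s in τ..x, a j s * picard a w s =
        ∫ s in τ..x, (if j = i then ((exp ((c * (s - τ : ℝ)) • X i)).1 * F) w else 0) * c := by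
      refine intervalIntegral.integral_congr_ae (Filter.Eventually.of_forall fun s hs => ?_)
      rw [Set.uIoc_of_le hx.1] at hs
      rw [hac j s ⟨hs.1, hs.2.trans hx.2⟩, ih ⟨hs.1.le, hs.2.trans hx.2⟩]
      split_ifs
      · ring
      · ring
    have e : picard a (j :: w) x = picard a (j :: w) τ + ∫ s in τ..x, a j s * picard a w s :=
      (intervalIntegral.integral_add_adjacent_intervals (hint 0 h0 τ hτ) (hint τ hτ x hxT)).symm
    rw [e, hcongr, hftc, sub_self]
    simp only [Complex.ofReal_zero, mul_zero, zero_smul, exp_zero, coe_one, one_mul]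
    rw [hF, ofCoeff_apply]
    ring

/-- Every element of the generated group is the monodromy of a piecewise constant path. -/
theorem exists_picard_eq {h : SeriesGroup} (hh : h ∈ generated {1, 2}) :
    ∀ τ ∈ Set.Ioc 0 T, ∃ a ∈ coeffSpaceUpTo T 2, ∀ w, picard a w τ = h.1 w := by
  have step : ∀ (c : ℂ) (i : ℕ+), i ∈ ({1, 2} : Set ℕ+) → ∀ g : SeriesGroup,
      (∀ τ ∈ Set.Ioc 0 T, ∃ a ∈ coeffSpaceUpTo T 2, ∀ w, picard a w τ = g.1 w) →
      ∀ τ ∈ Set.Ioc 0 T, ∃ a ∈ coeffSpaceUpTo T 2, ∀ w, picard a w τ =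
        (exp (c • X i) * g).1 w := by
    intro c i hi g ih τ hτ
    have hτ0 := hτ.1
    have hτT := hτ.2
    obtain ⟨a, ⟨⟨hm, C, hC⟩, ha2⟩, hag⟩ := ih (τ / 2) ⟨by linarith, by linarith⟩
    set z : ℂ := c / ((τ / 2 : ℝ) : ℂ) with hz
    -- Left multiplication by `exp (c • X i)` appends a segment. The path for `g` is run up to `τ /
    -- 2`, and the constant `z = c / (τ / 2)` then accumulates to `c` at time `τ`.
    set b : ℕ+ → ℝ → ℂ := fun j s => if s ≤ τ / 2 then a j s else if j = i then z else 0 with hb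
    -- The `+ 1` makes the bound at least `1`, so that its powers dominate the constant `z`; the
    -- absolute value is there because `C` may be negative.
    have hbs : b ∈ coeffSpace T := by
      refine ⟨fun j => Measurable.ite measurableSet_Iic (hm j) measurable_const,
        |C| + ‖z‖ + 1, fun j x hx => ?_⟩
      have h1 : 1 ≤ |C| + ‖z‖ + 1 := by
        have := abs_nonneg C; have := norm_nonneg z; linarith
      simp only [hb]
      split_ifs
      · refine (hC j x hx).trans ((le_abs_self _).trans ?_)
        rw [abs_pow]
        exact pow_le_pow_left₀ (abs_nonneg C) (by have := norm_nonneg z; linarith) _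
      · calc ‖z‖ ≤ |C| + ‖z‖ + 1 := by have := abs_nonneg C; linarith
          _ ≤ _ := le_self_pow₀ h1 j.pos.ne'
      · rw [norm_zero]; positivity
    refine ⟨b, ⟨hbs, fun j hj x hx => ?_⟩, fun w => ?_⟩
    · simp only [hb]
      have hji : j ≠ i := by
        rintro rfl
        rcases hi with rfl | hi
        · simp at hj
        · rw [Set.mem_singleton_iff] at hi
          subst hi
          simp at hj
      rw [ha2 j hj x hx, if_neg hji, ite_self]
    · have hτ2 : τ / 2 ∈ Set.Icc 0 T := ⟨by linarith, by linarith⟩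
      rw [picard_extend (by linarith) hbs hτ2 i z (fun j x hx => if_neg (not_le.mpr hx.1)) w
        (x := τ) ⟨by linarith, hτT⟩]
      have e1 : (ofCoeff fun w => picard b w (τ / 2)) = g.1 := by
        funext w
        rw [← hag w]
        exact picard_congr (τ := τ / 2) (fun j x hx => if_pos hx.2) w ⟨by linarith, le_rfl⟩
      have e2 : z * ((τ - τ / 2 : ℝ) : ℂ) = c := by
        have e3 : τ - τ / 2 = τ / 2 := by ring
        have h3 : ((τ / 2 : ℝ) : ℂ) ≠ 0 := Complex.ofReal_ne_zero.mpr (by linarith)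
        rw [e3, hz, div_mul_cancel₀ _ h3]
      rw [e1, e2]
      rfl
  induction hh using Subgroup.closure_induction_left with
  | one =>
    intro τ hτ
    refine ⟨fun _ _ => 0, ⟨⟨fun _ => measurable_const, 0, fun i x _ => by simp⟩,
      fun _ _ _ _ => rfl⟩, fun w => ?_⟩
    match w with
    | [] => rfl
    | i :: w => rw [picard]; simp [coe_one, one_cons]
  | mul_left x hx y hy ih =>
    obtain ⟨c, i, hi, rfl⟩ := hx
    exact step c i hi y ih
  | inv_mul_cancel x hx y hy ih =>
    obtain ⟨c, i, hi, rfl⟩ := hx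
    rw [inv_eq_of_mul_eq_one_right (exp_smul_X_mul_exp_neg i c)]
    exact step (-c) i hi y ih

/-- Monodromies lie in the closed group of group-like series, while those of piecewise constant
paths already form a dense subset of it. -/
theorem formalPathsUpTo_two (hT : 0 < T) :
    formalPathsUpTo T 2 = (abelGroupLike : Set SeriesGroup) := by
  refine Set.Subset.antisymm ?_ ?_
  · refine closure_minimal ?_ isClosed_abelGroupLike
    rintro g ⟨a, ha, rfl⟩
    refine ⟨isGroupLike_monodromy hT.le ha.1, fun w hw => ?_⟩
    refine picard_eq_zero (A := {1, 2}) (T := T) (fun i hi x hx => ha.2 i ?_ x hx) hw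
      ⟨hT.le, le_rfl⟩
    by_contra h
    have h1 := i.pos
    apply hi
    have : (i : ℕ) = 1 ∨ (i : ℕ) = 2 := by omega
    rcases this with h | h
    · exact Or.inl (PNat.coe_injective h)
    · exact Or.inr (PNat.coe_injective h)
  · refine (subset_closure_generated _).trans (closure_mono fun h hh => ?_)
    obtain ⟨a, ha, hah⟩ := exists_picard_eq hh T ⟨hT, le_rfl⟩
    exact ⟨a, ha, ext_apply hah⟩

end Picard

end CenterProblem

/-! ### The action by vector fields and the first return map. -/

namespace CenterProblem

open Series SeriesGroup

theorem length_le_weight (w : List ℕ+) : w.length ≤ weight w := by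
  induction w with
  | nil => exact le_rfl
  | cons i w ih =>
    rw [weight_cons, List.length_cons]
    have := i.pos
    omega

/-- The pairs of words of total weight `n`. -/
def wordPairs (n : ℕ) : Finset (List ℕ+ × List ℕ+) :=
  (Finset.HasAntidiagonal.antidiagonal n).biUnion fun ij => words ij.1 ×ˢ words ij.2

theorem mem_wordPairs {n : ℕ} {p : List ℕ+ × List ℕ+} :
    p ∈ wordPairs n ↔ weight p.1 + weight p.2 = n := by
  simp only [wordPairs, Finset.mem_biUnion, Finset.HasAntidiagonal.mem_antidiagonal,
    Finset.mem_product, mem_words]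
  constructor
  · rintro ⟨ij, h, h1, h2⟩
    rw [h1, h2, h]
  · intro h
    exact ⟨(weight p.1, weight p.2), h, rfl, rfl⟩

theorem sum_wordPairs {M : Type*} [AddCommMonoid M] (n : ℕ) (F : List ℕ+ × List ℕ+ → M) :
    ∑ p ∈ wordPairs n, F p = ∑ ij ∈ Finset.HasAntidiagonal.antidiagonal n,
      ∑ u ∈ words ij.1, ∑ v ∈ words ij.2, F (u, v) := by
  rw [wordPairs, Finset.sum_biUnion]
  · exact Finset.sum_congr rfl fun ij _ => Finset.sum_product _ _ _
  · intro a _ b _ hab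
    refine Finset.disjoint_left.mpr fun p hp hp' => hab ?_
    rw [Finset.mem_product, mem_words, mem_words] at hp hp'
    exact Prod.ext (hp.1.symm.trans hp'.1) (hp.2.symm.trans hp'.2)

theorem sum_wordPairs_swap {M : Type*} [AddCommMonoid M] (n : ℕ) (F : List ℕ+ × List ℕ+ → M) :
    ∑ p ∈ wordPairs n, F p = ∑ p ∈ wordPairs n, F p.swap :=
  Finset.sum_nbij' Prod.swap Prod.swap
    (fun p hp => by rw [mem_wordPairs] at hp ⊢; simpa [add_comm] using hp)
    (fun p hp => by rw [mem_wordPairs] at hp ⊢; simpa [add_comm] using hp)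
    (fun _ _ => rfl) (fun _ _ => rfl) (fun _ _ => rfl)

/-- Summation over all factorizations of the words of weight `n`. -/
theorem sum_words_splits {M : Type*} [AddCommMonoid M] (n : ℕ) (F : List ℕ+ × List ℕ+ → M) :
    ∑ w ∈ words n, ∑ j ∈ Finset.range (w.length + 1), F (w.take j, w.drop j) =
      ∑ p ∈ wordPairs n, F p := by
  rw [Finset.sum_sigma']
  refine Finset.sum_nbij' (fun x => (x.1.take x.2, x.1.drop x.2))
    (fun p => ⟨p.1 ++ p.2, p.1.length⟩) ?_ ?_ ?_ ?_ ?_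
  · rintro ⟨w, j⟩ h
    rw [Finset.mem_sigma, mem_words] at h
    rw [mem_wordPairs, weight_take_add_drop]
    exact h.1
  · rintro ⟨u, v⟩ h
    rw [mem_wordPairs] at h
    simp only [Finset.mem_sigma, mem_words, weight_append, Finset.mem_range, List.length_append]
    exact ⟨h, by omega⟩
  · rintro ⟨w, j⟩ h
    simp only [Finset.mem_sigma, Finset.mem_range] at h
    simp only [List.take_append_drop, List.length_take, Sigma.mk.injEq, heq_eq_eq, true_and]
    omega
  · rintro ⟨u, v⟩ _
    simp
  · intros
    rfl

theorem succPNat_sub_one (i : ℕ+) : ((i : ℕ) - 1).succPNat = i :=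
  PNat.coe_injective (Nat.succ_pred_eq_of_pos i.pos)

theorem sum_words_succ {M : Type*} [AddCommMonoid M] (n : ℕ) (F : List ℕ+ → M) :
    ∑ w ∈ words (n + 1), F w = ∑ k ∈ Finset.range (n + 1), ∑ w ∈ words (n - k),
      F (k.succPNat :: w) := by
  rw [Finset.sum_sigma']
  refine (Finset.sum_nbij' (fun x => x.1.succPNat :: x.2)
    (fun w => ⟨(w.headD 1 : ℕ) - 1, w.tail⟩) ?_ ?_ ?_ ?_ ?_).symm
  · rintro ⟨k, w⟩ h
    simp only [Finset.mem_sigma, Finset.mem_range, mem_words] at h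
    rw [mem_words, weight_cons, Nat.succPNat_coe]
    dsimp only
    omega
  · intro w h
    rw [mem_words] at h
    match w with
    | [] => simp [weight_nil] at h
    | i :: w =>
      rw [weight_cons] at h
      have := i.pos
      simp only [Finset.mem_sigma, Finset.mem_range, mem_words, List.headD_cons, List.tail_cons]
      omega
  · rintro ⟨k, w⟩ _
    simp
  · intro w h
    rw [mem_words] at h
    match w with
    | [] => simp [weight_nil] at h
    | i :: w => simp [succPNat_sub_one]
  · intros
    rfl

theorem sum_wordPairs_succ {M : Type*} [AddCommMonoid M] (n : ℕ) (F : List ℕ+ × List ℕ+ → M)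
    (hF : ∀ v, F ([], v) = 0) :
    ∑ p ∈ wordPairs (n + 1), F p = ∑ k ∈ Finset.range (n + 1), ∑ p ∈ wordPairs (n - k),
      F (k.succPNat :: p.1, p.2) := by
  rw [Finset.sum_sigma']
  refine (Finset.sum_of_injOn (fun x => (x.1.succPNat :: x.2.1, x.2.2)) ?_ ?_ ?_ ?_).symm
  · rintro ⟨k, u, v⟩ _ ⟨l, u', v'⟩ _ h
    simp only [Prod.mk.injEq, List.cons.injEq, Nat.succPNat_inj] at h
    obtain ⟨⟨rfl, rfl⟩, rfl⟩ := h
    rfl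
  · rintro ⟨k, u, v⟩ h
    simp only [Finset.coe_sigma, Set.mem_sigma_iff, Finset.mem_coe, Finset.mem_range,
      mem_wordPairs] at h
    rw [Finset.mem_coe, mem_wordPairs]
    simp only [weight_cons, Nat.succPNat_coe]
    omega
  · rintro ⟨u, v⟩ h hn
    rw [mem_wordPairs] at h
    match u with
    | [] => exact hF v
    | i :: u =>
      rw [weight_cons] at h
      have := i.pos
      refine absurd ⟨⟨(i : ℕ) - 1, u, v⟩, ?_, ?_⟩ hn
      · simp only [Finset.coe_sigma, Set.mem_sigma_iff, Finset.mem_coe, Finset.mem_range,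
          mem_wordPairs]
        simp only at h
        omega
      · simp [succPNat_sub_one]
  · intros
    rfl

/-- The product `m (m + i₁) ⋯ (m + i₁ + ⋯ + i_{k-1})`, the coefficient of the image of `r ^ m`
under the composition of the vector fields `r ^ (i + 1) d/dr` indexed by the word. -/
def vectorFieldCoeff : ℕ → List ℕ+ → ℂ
  | _, [] => 1
  | m, i :: w => m * vectorFieldCoeff (m + i) w

theorem vectorFieldCoeff_append (m : ℕ) (u v : List ℕ+) :
    vectorFieldCoeff m (u ++ v) = vectorFieldCoeff m u * vectorFieldCoeff (m + weight u) v := by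
  induction u generalizing m with
  | nil => simp [vectorFieldCoeff, weight_nil]
  | cons i u ih => rw [List.cons_append, vectorFieldCoeff, vectorFieldCoeff, ih, weight_cons,
      mul_assoc, add_assoc]

/-- The coefficient of `r ^ (m + n)` in the image of `r ^ m` under the action of a series by
vector fields. -/
noncomputable def action (m n : ℕ) : Series →ₗ[ℂ] ℂ where
  toFun f := ∑ w ∈ words n, vectorFieldCoeff m w * f w
  map_add' f g := by simp only [add_apply, mul_add, Finset.sum_add_distrib]
  map_smul' c f := by
    simp only [Series.smul_apply, Finset.mul_sum, smul_eq_mul, RingHom.id_apply]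
    exact Finset.sum_congr rfl fun _ _ => by ring

theorem action_apply (m n : ℕ) (f : Series) :
    action m n f = ∑ w ∈ words n, vectorFieldCoeff m w * f w := rfl

theorem continuous_action (m n : ℕ) : Continuous (action m n) :=
  continuous_finsetSum (words n) fun w _ => continuous_const.mul (Series.continuous_coeff w)

theorem action_congr {m n : ℕ} {f g : Series} (h : ∀ w, weight w = n → f w = g w) :
    action m n f = action m n g := by
  rw [action_apply, action_apply]
  exact Finset.sum_congr rfl fun w hw => by rw [h w (mem_words.mp hw)]

theorem action_of_vanishesBelow_sub {m n : ℕ} {f g : Series}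
    (h : VanishesBelow (n + 1) (f - g)) : action m n f = action m n g :=
  action_congr fun _ hw => apply_of_vanishesBelow_sub h (by omega)

theorem action_eq_zero {m n k : ℕ} {f : Series} (hf : IsHomogeneous k f) (h : n ≠ k) :
    action m n f = 0 := by
  rw [action_apply]
  exact Finset.sum_eq_zero fun w hw => by rw [hf w (by rw [mem_words.mp hw]; exact h), mul_zero]

theorem action_one (m : ℕ) {n : ℕ} (hn : n ≠ 0) : action m n 1 = 0 := by
  rw [action_apply]
  refine Finset.sum_eq_zero fun w hw => ?_
  match w with
  | [] => exact absurd (mem_words.mp hw).symm hn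
  | i :: w => rw [one_cons, mul_zero]

/-- A right action: `f` is applied first, taking `r ^ m` to a multiple of `r ^ (m + i)`, on which
`g` then acts. -/
theorem action_mul (m n : ℕ) (f g : Series) :
    action m n (f * g) = ∑ ij ∈ Finset.HasAntidiagonal.antidiagonal n,
      action m ij.1 f * action (m + ij.1) ij.2 g := by
  set F : List ℕ+ × List ℕ+ → ℂ := fun p =>
    vectorFieldCoeff m p.1 * f p.1 * (vectorFieldCoeff (m + weight p.1) p.2 * g p.2) with hF
  have h : ∀ w ∈ words n, vectorFieldCoeff m w * (f * g) w =
      ∑ j ∈ Finset.range (w.length + 1), F (w.take j, w.drop j) := by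
    intro w _
    simp only [hF]
    rw [mul_apply, Finset.mul_sum]
    refine Finset.sum_congr rfl fun j _ => ?_
    conv_lhs => rw [← List.take_append_drop j w, vectorFieldCoeff_append, List.take_append_drop]
    ring
  rw [action_apply, Finset.sum_congr rfl h, sum_words_splits, sum_wordPairs]
  refine Finset.sum_congr rfl fun ij _ => ?_
  rw [action_apply, action_apply, Finset.sum_mul_sum]
  refine Finset.sum_congr rfl fun u hu => Finset.sum_congr rfl fun v _ => ?_
  simp only [hF]
  rw [mem_words.mp hu]

/-- Vector fields are derivations. -/
theorem action_add (n : ℕ) : ∀ (m m' : ℕ) (f : Series), action (m + m') n f =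
    ∑ p ∈ wordPairs n, vectorFieldCoeff m p.1 * vectorFieldCoeff m' p.2 *
      shuffleCoeff p.1 p.2 f := by
  induction n using Nat.strong_induction_on with
  | _ n ih =>
    intro m m' f
    match n with
    | 0 =>
      have h1 : words 0 = {[]} := by
        ext w; rw [mem_words, weight_eq_zero, Finset.mem_singleton]
      have h2 : wordPairs 0 = {([], [])} := by
        ext p
        rw [mem_wordPairs, Finset.mem_singleton, Nat.add_eq_zero_iff, weight_eq_zero,
          weight_eq_zero, Prod.ext_iff]
      rw [action_apply, h1, h2, Finset.sum_singleton, Finset.sum_singleton]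
      simp [vectorFieldCoeff, shuffleCoeff_nil_left]
    | n + 1 =>
      -- `A` and `B` collect the shuffles whose first letter comes from the first or the second
      -- word. They match the two summands of the factor `m + m'` produced by the first vector
      -- field, as in the Leibniz rule.
      set A : List ℕ+ × List ℕ+ → ℂ := fun p => match p.1 with
        | [] => 0
        | i :: u => vectorFieldCoeff m p.1 * vectorFieldCoeff m' p.2 *
          shuffleCoeff u p.2 (f.shift i) with hA
      set B : List ℕ+ × List ℕ+ → ℂ := fun p => match p.2 with
        | [] => 0
        | j :: v => vectorFieldCoeff m p.1 * vectorFieldCoeff m' p.2 *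
          shuffleCoeff p.1 v (f.shift j) with hB
      have hAB : ∀ p ∈ wordPairs (n + 1), vectorFieldCoeff m p.1 * vectorFieldCoeff m' p.2 *
          shuffleCoeff p.1 p.2 f = A p + B p := by
        rintro ⟨u, v⟩ hp
        match u, v with
        | [], [] => simp [mem_wordPairs, weight_nil] at hp
        | [], j :: v => simp [hA, hB, shuffleCoeff_nil_left, shift_apply]
        | i :: u, [] => simp [hA, hB, shuffleCoeff_nil_right, shift_apply]
        | i :: u, j :: v => simp only [hA, hB, shuffleCoeff_cons_cons]; ring
      rw [Finset.sum_congr rfl hAB, Finset.sum_add_distrib, sum_wordPairs_swap _ B,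
        sum_wordPairs_succ _ A fun v => rfl, sum_wordPairs_succ _ _ fun v => rfl, action_apply,
        sum_words_succ, ← Finset.sum_add_distrib]
      refine Finset.sum_congr rfl fun k hk => ?_
      have e1 := ih (n - k) (by omega) (m + k.succPNat) m' (f.shift k.succPNat)
      have e2 := ih (n - k) (by omega) m (m' + k.succPNat) (f.shift k.succPNat)
      rw [sum_wordPairs_swap] at e2
      have e3 : ∑ w ∈ words (n - k), vectorFieldCoeff (m + m') (k.succPNat :: w) *
          f (k.succPNat :: w) = (m + m') * action (m + m' + k.succPNat) (n - k)
            (f.shift k.succPNat) := by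
        rw [action_apply, Finset.mul_sum]
        refine Finset.sum_congr rfl fun w _ => ?_
        rw [vectorFieldCoeff, shift_apply]
        push_cast
        ring
      rw [e3, add_mul]
      congr 1
      · rw [add_right_comm, e1, Finset.mul_sum]
        refine Finset.sum_congr rfl fun p _ => ?_
        simp only [hA, vectorFieldCoeff]
        ring
      · rw [add_assoc, e2, Finset.mul_sum]
        refine Finset.sum_congr rfl fun p _ => ?_
        simp only [hB, vectorFieldCoeff, Prod.fst_swap, Prod.snd_swap, Prod.swap_prod_mk]
        ring

/-- Exponentiated derivations are multiplicative: the image of `r ^ (m + m')` is the product of the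
images of `r ^ m` and `r ^ m'`. -/
theorem Series.IsGroupLike.action_add {f : Series} (hf : IsGroupLike f) (m m' n : ℕ) :
    action (m + m') n f = ∑ ij ∈ Finset.HasAntidiagonal.antidiagonal n,
      action m ij.1 f * action m' ij.2 f := by
  rw [CenterProblem.action_add, sum_wordPairs]
  refine Finset.sum_congr rfl fun ij _ => ?_
  rw [action_apply, action_apply, Finset.sum_mul_sum]
  refine Finset.sum_congr rfl fun u _ => Finset.sum_congr rfl fun v _ => ?_
  rw [hf]
  ring

/-- The action of a group-like series is determined by its value at `r`. -/
theorem action_eq_of_action_one_eq {f g : SeriesGroup} (hf : f ∈ groupLike) (hg : g ∈ groupLike)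
    (h : ∀ n, action 1 n f.1 = action 1 n g.1) (m n : ℕ) : action m n f.1 = action m n g.1 := by
  induction m generalizing n with
  | zero =>
    -- Vector fields kill the constant `r ^ 0`, so only the empty word contributes.
    rw [action_apply, action_apply]
    refine Finset.sum_congr rfl fun w _ => ?_
    match w with
    | [] => rw [f.2, g.2]
    | i :: w => simp [vectorFieldCoeff]
  | succ m ih =>
    rw [Series.IsGroupLike.action_add hf, Series.IsGroupLike.action_add hg]
    exact Finset.sum_congr rfl fun ij _ => by rw [ih, h]

/-- At the total weight, subtracting the first `j` letters leaves the sum of the remaining ones; the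
factors are thus `1` plus the partial sums counted from the end. -/
theorem pPoly_map_val (w : List ℕ+) :
    pPoly (w.map PNat.val) (weight w) = vectorFieldCoeff 1 w.reverse := by
  induction w with
  | nil => rfl
  | cons i w ih =>
    have e : ((weight (i :: w) : ℕ) : ℂ) - ((i : ℕ) : ℂ) = weight w := by
      rw [weight_cons]; push_cast; ring
    rw [List.map_cons, pPoly, List.reverse_cons, vectorFieldCoeff_append, ← ih]
    change (((weight (i :: w) : ℕ) : ℂ) - ((i : ℕ) : ℂ) + 1) *
      pPoly (List.map PNat.val w) (((weight (i :: w) : ℕ) : ℂ) - ((i : ℕ) : ℂ)) = _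
    rw [e, weight_perm w.reverse_perm]
    simp only [vectorFieldCoeff]
    push_cast
    ring

theorem d_firstReturn (g : SeriesGroup) (n : ℕ+) :
    (firstReturn g).d n = action 1 n g.1 := by
  have h1 : (firstReturn g).d n = ∑ c : Composition (n : ℕ),
      pPoly c.blocks ((n : ℕ) : ℂ) * g.iteratedIntegral (c.blocks.map Nat.toPNat') := by
    rw [FormalGerm.d, firstReturn, PowerSeries.coeff_mk]
  have h2 : action 1 n g.1 = ∑ w ∈ words n, vectorFieldCoeff 1 w.reverse * g.1 w.reverse := by
    rw [action_apply]
    refine Finset.sum_nbij' List.reverse List.reverse ?_ ?_ ?_ ?_ ?_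
    · intro w hw
      rw [mem_words] at hw ⊢
      rw [weight_perm w.reverse_perm, hw]
    · intro w hw
      rw [mem_words] at hw ⊢
      rw [weight_perm w.reverse_perm, hw]
    · intros; simp
    · intros; simp
    · intros; simp
  have hval : ∀ c : Composition (n : ℕ), (c.blocks.map Nat.toPNat').map PNat.val = c.blocks :=
    fun c => map_val_map_toPNat' fun i hi => c.blocks_pos hi
  rw [h1, h2, words, Finset.sum_image]
  · refine Finset.sum_congr rfl fun c _ => ?_
    rw [← pPoly_map_val, weight, hval, c.blocks_sum]
    rfl
  · intro c _ c' _ h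
    have := congrArg (List.map PNat.val) h
    rw [hval, hval] at this
    exact Composition.ext this

theorem FormalGerm.d_injective : Function.Injective FormalGerm.d := by
  intro f g h
  refine Subtype.ext (PowerSeries.ext fun n => ?_)
  match n with
  | 0 => rw [f.2.1, g.2.1]
  | 1 => rw [f.2.2, g.2.2]
  | n + 2 => exact congrFun h n.succPNat

theorem firstReturn_eq_iff {f g : SeriesGroup} :
    firstReturn f = firstReturn g ↔ ∀ n, action 1 n f.1 = action 1 n g.1 := by
  constructor
  · intro h n
    match n with
    | 0 =>
      refine action_congr fun w hw => ?_
      rw [weight_eq_zero.mp hw, f.2, g.2]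
    | n + 1 =>
      have e := d_firstReturn f n.succPNat
      rw [h, d_firstReturn] at e
      exact e.symm
  · intro h
    refine FormalGerm.d_injective (funext fun n => ?_)
    rw [d_firstReturn, d_firstReturn, h]

theorem firstReturn_one : firstReturn 1 = FormalGerm.id := by
  refine FormalGerm.d_injective (funext fun n => ?_)
  rw [d_firstReturn, coe_one, action_one 1 n.pos.ne']
  rw [FormalGerm.d, FormalGerm.id, PowerSeries.coeff_X, if_neg]
  have := n.pos
  omega

/-- The right factor acts on the image of `r` under `f`, and a group-like action on all powers of
`r` is determined by its effect on `r`. No condition on `f` is required. -/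
theorem firstReturn_mul_congr (f : SeriesGroup) {g h : SeriesGroup} (hg : g ∈ groupLike)
    (hh : h ∈ groupLike) (e : firstReturn g = firstReturn h) :
    firstReturn (f * g) = firstReturn (f * h) := by
  rw [firstReturn_eq_iff] at e ⊢
  intro n
  rw [coe_mul, coe_mul, action_mul, action_mul]
  exact Finset.sum_congr rfl fun ij _ => by rw [action_eq_of_action_one_eq hg hh e]

theorem continuous_firstReturn : Continuous firstReturn := by
  refine continuous_induced_rng.mpr (continuous_pi fun n => ?_)
  change Continuous fun g => (firstReturn g).d n
  simp only [d_firstReturn]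
  exact (continuous_action 1 n).comp continuous_subtype_val

theorem FormalGerm.continuous_d (n : ℕ+) : Continuous fun s : FormalGerm => s.d n :=
  (continuous_apply (A := fun _ : ℕ+ => ℂ) n).comp
    (continuous_induced_dom (f := FormalGerm.d))

theorem action_X (m : ℕ) (i : ℕ+) : action m i (X i) = m := by
  rw [action_apply, Finset.sum_eq_single [i]]
  · simp [vectorFieldCoeff, X]
  · intro w _ hw
    have : X i w = 0 := if_neg hw
    rw [this, mul_zero]
  · intro h
    exact absurd (mem_words.mpr (by simp [weight])) h

theorem action_mul_of_isHomogeneous {k l : ℕ} {f g : Series} (hf : IsHomogeneous k f) (m : ℕ) :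
    action m (k + l) (f * g) = action m k f * action (m + k) l g := by
  rw [action_mul, Finset.sum_eq_single (k, l)]
  · rintro ⟨a, b⟩ h hne
    rw [Finset.HasAntidiagonal.mem_antidiagonal] at h
    rw [action_eq_zero hf (n := a), zero_mul]
    rintro rfl
    simp only at h
    exact hne (by rw [Prod.mk.injEq]; omega)
  · intro h
    exact absurd (Finset.HasAntidiagonal.mem_antidiagonal.mpr (by rfl)) h

/-- Iterated commutators act as multiples of vector fields. -/
theorem action_nestedBracket (w : List ℕ+) (hw : w ≠ []) (m : ℕ) :
    action m (weight w) (nestedBracket w) = m * gam w := by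
  match w with
  | [i] =>
    have h := action_X m i
    simpa [nestedBracket, gam, weight] using h
  | i :: j :: w =>
    have ih := action_nestedBracket (j :: w) (by simp)
    have hQ := isHomogeneous_nestedBracket (j :: w)
    rw [nestedBracket, Ring.lie_def, weight_cons, map_sub,
      action_mul_of_isHomogeneous (isHomogeneous_X i), add_comm (i : ℕ),
      action_mul_of_isHomogeneous hQ, action_X, action_X, ih, ih, gam]
    push_cast
    ring

theorem gam_replicate (k : ℕ) :
    gam (List.replicate k 1 ++ [2]) = (-1) ^ k * (k.factorial : ℤ) ∧
      weight (List.replicate k 1 ++ [2]) = k + 2 := by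
  induction k with
  | zero => exact ⟨rfl, rfl⟩
  | succ k ih =>
    obtain ⟨j, w, h⟩ : ∃ j w, List.replicate k (1 : ℕ+) ++ [2] = j :: w :=
      List.exists_cons_of_ne_nil (by simp)
    rw [List.replicate_succ, List.cons_append]
    rw [h] at ih ⊢
    rw [gam, weight_cons 1, ih.1, ih.2, Nat.factorial_succ]
    constructor
    · push_cast
      ring
    · simp only [PNat.one_coe]
      ring

theorem isHomogeneous_rElem {n : ℕ} (hn : 2 ≤ n) : IsHomogeneous n (rElem n) := by
  have h := isHomogeneous_nestedBracket (List.replicate (n - 2) 1 ++ [2])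
  rw [(gam_replicate _).2, Nat.sub_add_cancel hn] at h
  exact h.smul _

/-- The scalar in `rElem` cancels the factor `(-1) ^ (n - 2) (n - 2)!` of the bracket, so `rElem n`
acts as `r ^ (n + 1) d/dr` itself. -/
theorem action_rElem {n : ℕ} (hn : 2 ≤ n) (m : ℕ) : action m n (rElem n) = m := by
  have h := action_nestedBracket (List.replicate (n - 2) 1 ++ [2]) (by simp) m
  rw [(gam_replicate _).1, (gam_replicate _).2, Nat.sub_add_cancel hn] at h
  have h0 : ((n - 2).factorial : ℂ) ≠ 0 := Nat.cast_ne_zero.mpr (Nat.factorial_ne_zero _)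
  have h1 : (-1 : ℂ) ^ n * (-1) ^ (n - 2) = 1 := by
    rw [← pow_add]
    exact Even.neg_one_pow ⟨n - 1, by omega⟩
  rw [rElem, map_smul, h, smul_eq_mul]
  push_cast
  field_simp
  linear_combination (m : ℂ) * h1

theorem isPrimitive_rElem (n : ℕ) : IsPrimitive (rElem n) := (isPrimitive_nestedBracket _).smul _

theorem supportedOn_rElem (n : ℕ) : SupportedOn {1, 2} (rElem n) := by
  refine (supportedOn_nestedBracket _ fun i hi => ?_).smul _
  rw [List.mem_append] at hi
  rcases hi with hi | hi
  · exact Or.inl (List.eq_of_mem_replicate hi)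
  · exact Or.inr (List.mem_singleton.mp hi)

theorem isHomogeneous_lElem {w : List ℕ+} (hw : 2 ≤ weight w) :
    IsHomogeneous (weight w) (lElem w) :=
  (isHomogeneous_nestedBracket w).sub ((isHomogeneous_rElem hw).smul _)

theorem isPrimitive_lElem (w : List ℕ+) : IsPrimitive (lElem w) :=
  (isPrimitive_nestedBracket w).sub ((isPrimitive_rElem _).smul _)

theorem supportedOn_lElem {w : List ℕ+} (hw : ∀ i ∈ w, i = 1 ∨ i = 2) :
    SupportedOn {1, 2} (lElem w) :=
  (supportedOn_nestedBracket w hw).sub ((supportedOn_rElem _).smul _)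

theorem action_lElem {w : List ℕ+} (hw : 2 ≤ weight w) (m n : ℕ) : action m n (lElem w) = 0 := by
  by_cases hn : n = weight w
  · have hw0 : w ≠ [] := by
      rintro rfl
      rw [weight_nil] at hw
      omega
    rw [hn, lElem, map_sub, map_smul, action_nestedBracket w hw0, action_rElem hw, smul_eq_mul]
    ring
  · exact action_eq_zero (isHomogeneous_lElem hw) hn

/-- The exponential of a series acting trivially does not change the first return map. -/
theorem firstReturn_exp {f : Series} (h0 : f [] = 0) (hf : ∀ m n, action m n f = 0) :
    firstReturn (exp f) = FormalGerm.id := by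
  rw [← firstReturn_one, firstReturn_eq_iff]
  intro n
  have h : action 1 n (exp f).1 =
      action 1 n (∑ k ∈ Finset.range (n + 1), (k.factorial : ℂ)⁻¹ • f ^ k) := by
    refine action_congr fun w hw => ?_
    rw [exp_apply h0 (N := n + 1) (by have := length_le_weight w; omega), Series.sum_apply]
    exact Finset.sum_congr rfl fun k _ => div_eq_inv_mul _ _
  rw [h, map_sum, Finset.sum_range_succ', Finset.sum_eq_zero, zero_add]
  · rw [pow_zero, map_smul, Nat.factorial_zero, Nat.cast_one, inv_one, one_smul, coe_one]
  · intro k _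
    -- Every positive power begins with a factor `f`, which acts by zero.
    rw [map_smul, pow_succ', action_mul, Finset.sum_eq_zero, smul_zero]
    intro ij _
    rw [hf, zero_mul]

end CenterProblem

/-! ### The section of the first return map and the group of centers. -/

namespace CenterProblem

open Series SeriesGroup

/-- The Lie elements acting as the vector fields `r ^ (n + 1) d/dr`, for `n ≥ 1`. -/
noncomputable def fieldElem (n : ℕ) : Series := if n ≤ 1 then X 1 else rElem n

theorem isHomogeneous_fieldElem {n : ℕ} (hn : 0 < n) : IsHomogeneous n (fieldElem n) := by
  rw [fieldElem]
  split_ifs with h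
  · obtain rfl : n = 1 := by omega
    exact isHomogeneous_X 1
  · exact isHomogeneous_rElem (by omega)

theorem action_fieldElem {n : ℕ} (hn : 0 < n) : action 1 n (fieldElem n) = 1 := by
  rw [fieldElem]
  split_ifs with h
  · obtain rfl : n = 1 := by omega
    simpa using action_X 1 1
  · simpa using action_rElem (n := n) (by omega) 1

theorem exp_smul_fieldElem_mem (c : ℂ) (n : ℕ) : exp (c • fieldElem n) ∈ abelGroupLike := by
  rw [fieldElem]
  split_ifs
  · exact ⟨isGroupLike_exp ((isPrimitive_X 1).smul c),
      supportedOn_exp ((supportedOn_X (Or.inl rfl)).smul c)⟩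
  · exact ⟨isGroupLike_exp ((isPrimitive_rElem n).smul c),
      supportedOn_exp ((supportedOn_rElem n).smul c)⟩

/-- The partial products of the section of the first return map. -/
noncomputable def partialSection (s : FormalGerm) : ℕ → SeriesGroup
  | 0 => 1
  | n + 1 => partialSection s n * exp
      ((s.d n.succPNat - action 1 (n + 1) (partialSection s n).1) • fieldElem (n + 1))

theorem partialSection_mem (s : FormalGerm) (n : ℕ) : partialSection s n ∈ abelGroupLike := by
  induction n with
  | zero => exact one_mem _
  | succ n ih => exact mul_mem ih (exp_smul_fieldElem_mem _ _)

theorem continuous_partialSection (n : ℕ) : Continuous fun s => partialSection s n := by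
  induction n with
  | zero => exact continuous_const
  | succ n ih =>
    exact continuous_mul_group ih (continuous_exp_smul ((FormalGerm.continuous_d _).sub
      ((continuous_action 1 (n + 1)).comp (continuous_subtype_val.comp ih))) _)

/-- The new factor leaves weights up to `n` untouched and in weight `n + 1` adds exactly the term
that corrects the coefficient `d` there. -/
theorem partialSection_succ_sub (s : FormalGerm) (n : ℕ) :
    VanishesBelow (n + 2) ((partialSection s (n + 1)).1 - ((partialSection s n).1 +
      (s.d n.succPNat - action 1 (n + 1) (partialSection s n).1) • fieldElem (n + 1))) := by
  rw [partialSection, coe_mul]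
  set g := (partialSection s n).1 with hg
  set P := (s.d n.succPNat - action 1 (n + 1) g) • fieldElem (n + 1)
  have hP : IsHomogeneous (n + 1) P := (isHomogeneous_fieldElem n.succ_pos).smul _
  have e : g * (exp P).1 - (g + P) = g * ((exp P).1 - (1 + P)) + (g - 1) * P := by noncomm_ring
  rw [e]
  exact ((vanishesBelow_exp n.succ_pos hP).mul_left _).add
    (((vanishesBelow_one_sub (partialSection s n).2).mul hP.vanishesBelow).mono (by omega))

theorem partialSection_sub (s : FormalGerm) {n m : ℕ} (h : n ≤ m) :
    VanishesBelow (n + 1) ((partialSection s m).1 - (partialSection s n).1) := by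
  induction m, h using Nat.le_induction with
  | base => rw [sub_self]; exact fun _ _ => rfl
  | succ m hm ih =>
    have h1 := (partialSection_succ_sub s m).mono (show n + 1 ≤ m + 2 by omega)
    have h2 := ((isHomogeneous_fieldElem (Nat.add_one_pos m)).smul
      (s.d m.succPNat - action 1 (m + 1) (partialSection s m).1)).vanishesBelow.mono
        (show n + 1 ≤ m + 1 by omega)
    set P := (s.d m.succPNat - action 1 (m + 1) (partialSection s m).1) • fieldElem (m + 1)
    have e : (partialSection s (m + 1)).1 - (partialSection s n).1 =
        (partialSection s (m + 1)).1 - ((partialSection s m).1 + P) + P +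
          ((partialSection s m).1 - (partialSection s n).1) := by abel
    rw [e]
    exact (h1.add h2).add ih

/-- The section of the first return map. -/
noncomputable def returnSection (s : FormalGerm) : SeriesGroup :=
  ⟨fun w => (partialSection s (weight w)).1 w, (partialSection s 0).2⟩

theorem returnSection_sub (s : FormalGerm) (n : ℕ) :
    VanishesBelow (n + 1) ((returnSection s).1 - (partialSection s n).1) := by
  intro w hw
  have h := partialSection_sub s (show weight w ≤ n by omega) w (Nat.lt_succ_self _)
  rw [sub_apply] at h ⊢
  exact sub_eq_zero.mpr (sub_eq_zero.mp h).symm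

theorem returnSection_mem (s : FormalGerm) : returnSection s ∈ abelGroupLike := by
  refine isClosed_abelGroupLike.mem_of_tendsto (b := Filter.atTop) (f := partialSection s)
    (tendsto_of_coeff fun w => ?_) (Filter.Eventually.of_forall (partialSection_mem s))
  refine tendsto_const_nhds.congr' ?_
  filter_upwards [Filter.eventually_ge_atTop (weight w)] with n hn
  exact apply_of_vanishesBelow_sub (returnSection_sub s n) (Nat.lt_succ_of_le hn)

theorem continuous_returnSection : Continuous returnSection :=
  SeriesGroup.continuous_of_coeff (F := returnSection) fun w =>
    show Continuous fun s => (partialSection s (weight w)).1 w from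
      (SeriesGroup.continuous_coeff w).comp (continuous_partialSection (weight w))

theorem firstReturn_returnSection (s : FormalGerm) : firstReturn (returnSection s) = s := by
  refine FormalGerm.d_injective (funext fun n => ?_)
  obtain ⟨k, rfl⟩ : ∃ k : ℕ, k.succPNat = n := ⟨_, succPNat_sub_one n⟩
  rw [d_firstReturn, Nat.succPNat_coe, Nat.succ_eq_add_one,
    action_of_vanishesBelow_sub (returnSection_sub s (k + 1)),
    action_of_vanishesBelow_sub (partialSection_succ_sub s k), map_add, map_smul,
    action_fieldElem k.succ_pos, smul_eq_mul]
  ring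

theorem abelFormalCenters_eq {T : ℝ} (hT : 0 < T) :
    abelFormalCenters T = {g | g ∈ abelGroupLike ∧ firstReturn g = FormalGerm.id} := by
  have hsub : formalPathsUpTo T 2 ⊆ formalPaths T :=
    closure_mono (Set.image_mono fun a ha => ha.1)
  ext g
  rw [abelFormalCenters, formalCenters, formalPathsUpTo_two hT] at *
  constructor
  · rintro ⟨⟨-, h⟩, hg⟩
    exact ⟨hg, h⟩
  · rintro ⟨hg, h⟩
    exact ⟨⟨hsub hg, h⟩, hg⟩

/-- With `firstReturn_mul` this identifies the fibres of the first return map with the left cosets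
of the centers. -/
theorem firstReturn_inv_mul {g h : SeriesGroup} (hg : g ∈ abelGroupLike) (hh : h ∈ abelGroupLike)
    (e : firstReturn g = firstReturn h) : firstReturn (g⁻¹ * h) = FormalGerm.id := by
  rw [← firstReturn_mul_congr g⁻¹ hg.1 hh.1 e, inv_mul_cancel, firstReturn_one]

theorem firstReturn_mul {g h : SeriesGroup} (hh : h ∈ abelGroupLike)
    (e : firstReturn h = FormalGerm.id) : firstReturn (g * h) = firstReturn g := by
  rw [firstReturn_mul_congr g hh.1 (one_mem groupLike) (e.trans firstReturn_one.symm), mul_one]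

theorem abelCenterGenerated_subset :
    (abelCenterGenerated : Set SeriesGroup) ⊆
      {g | g ∈ abelGroupLike ∧ firstReturn g = FormalGerm.id} := by
  intro g hg
  induction hg using Subgroup.closure_induction with
  | mem x hx =>
    obtain ⟨c, w, hw, hn, rfl⟩ := hx
    have h2 : 2 ≤ weight w := by omega
    refine ⟨⟨isGroupLike_exp ((isPrimitive_lElem w).smul c),
      supportedOn_exp ((supportedOn_lElem hw).smul c)⟩,
      firstReturn_exp ((isPrimitive_lElem w).smul c).1 fun m n => ?_⟩
    rw [map_smul, action_lElem h2, smul_zero]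
  | one => exact ⟨one_mem _, firstReturn_one⟩
  | mul x y _ _ hx hy => exact ⟨mul_mem hx.1 hy.1, (firstReturn_mul hy.1 hy.2).trans hx.2⟩
  | inv x _ hx =>
    refine ⟨inv_mem hx.1, ?_⟩
    have h := firstReturn_inv_mul hx.1 (one_mem _) (hx.2.trans firstReturn_one.symm)
    rwa [mul_one] at h

/-- The Lie elements of weight 2, 3 and 4 in `X₁`, `X₂` are the multiples of `X₂`, `[X₁, X₂]` and
`[X₁, [X₁, X₂]]`, that is, of `r_n`. There is no room for a bracket acting trivially. -/
theorem lElem_eq_zero {w : List ℕ+} (hw : ∀ i ∈ w, i = 1 ∨ i = 2) (h2 : 2 ≤ weight w)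
    (h4 : weight w ≤ 4) : lElem w = 0 := by
  have skew : ⁅X 2, X 1⁆ = -⁅X 1, X 2⁆ := by
    rw [Ring.lie_def, Ring.lie_def, neg_sub]
  have self (i : ℕ+) : ⁅X i, X i⁆ = 0 := by rw [Ring.lie_def, sub_self]
  have lie0 (f : Series) : ⁅f, (0 : Series)⁆ = 0 := by
    rw [Ring.lie_def, mul_zero, zero_mul, sub_zero]
  have lieneg (f g : Series) : ⁅f, -g⁆ = -⁅f, g⁆ := by
    rw [Ring.lie_def, Ring.lie_def, mul_neg, neg_mul, neg_sub, sub_neg_eq_add, neg_add_eq_sub]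
  match w with
  | [] => simp [weight] at h2
  | [a] =>
    simp only [List.mem_singleton, forall_eq] at hw
    rcases hw with rfl | rfl
    · simp [weight] at h2
    · simp [lElem, nestedBracket, gam, rElem, weight]
  | [a, b] =>
    simp only [List.mem_cons, List.not_mem_nil, or_false, forall_eq_or_imp, forall_eq] at hw
    obtain ⟨rfl | rfl, rfl | rfl⟩ := hw <;>
      simp [lElem, nestedBracket, gam, rElem, weight, skew, self] <;> module
  | [a, b, c] =>
    simp only [List.mem_cons, List.not_mem_nil, or_false, forall_eq_or_imp, forall_eq] at hw
    obtain ⟨rfl | rfl, rfl | rfl, rfl | rfl⟩ := hw <;>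
      simp [weight] at h4 <;>
      simp [lElem, nestedBracket, gam, rElem, weight, skew, self, lie0, lieneg] <;> module
  | [a, b, c, d] =>
    simp only [List.mem_cons, List.not_mem_nil, or_false, forall_eq_or_imp, forall_eq] at hw
    obtain ⟨rfl | rfl, rfl | rfl, rfl | rfl, rfl | rfl⟩ := hw <;>
      simp [weight] at h4 <;>
      simp [lElem, nestedBracket, gam, rElem, weight, self, lie0]
  | a :: b :: c :: d :: e :: w =>
    have := length_le_weight (a :: b :: c :: d :: e :: w)
    simp only [List.length_cons] at this
    omega

/-- The leading component of a center is primitive and kills `r`, hence is a combination of the `l`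
elements, whose exponentials can be used for the next approximation. -/
theorem subset_closure_abelCenterGenerated :
    {g | g ∈ abelGroupLike ∧ firstReturn g = FormalGerm.id} ⊆
      closure (abelCenterGenerated : Set SeriesGroup) := by
  refine subset_closure_of_approx _ _ (fun k hk g hg => ?_) fun n hn g hg hgn => ?_
  · have hk' := abelCenterGenerated_subset hk
    exact ⟨mul_mem (inv_mem hk'.1) hg.1, firstReturn_inv_mul hk'.1 hg.1 (hk'.2.trans hg.2.symm)⟩
  set P := component n g.1 with hP
  have hsupp : SupportedOn {1, 2} P := fun w hw => by
    rw [hP, component_apply, hg.1.2 w hw, ite_self]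
  have hprim := IsGroupLike.isPrimitive_component hg.1.1 hn hgn
  have hact : action 1 n P = 0 := by
    have h := firstReturn_eq_iff.mp (hg.2.trans firstReturn_one.symm) n
    rw [action_of_vanishesBelow_sub (vanishesBelow_sub_component hn hgn), map_add] at h
    exact add_eq_left.mp h
  have hsum : P = ∑ w ∈ words n, (lastLetter w * P w / n) • nestedBracket w :=
    hprim.eq_sum_nestedBracket hn (isHomogeneous_component n g.1)
  suffices h : ∃ k ∈ abelCenterGenerated, VanishesBelow (n + 1) (k.1 - (1 + P)) by
    obtain ⟨k, hk, hk'⟩ := h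
    refine ⟨k, hk, ?_⟩
    have e : k.1 - g.1 = (k.1 - (1 + P)) - (g.1 - (1 + P)) := by abel
    rw [e]
    exact hk'.sub (vanishesBelow_sub_component hn hgn)
  have htriv : VanishesBelow (n + 1) ((1 : SeriesGroup).1 - (1 + 0)) := by
    rw [add_zero, coe_one, sub_self]
    exact fun _ _ => rfl
  -- There is no `r_1`. In weight 1 the component is a multiple of `X₁`, which does not kill `r`, so
  -- it vanishes.
  by_cases hn1 : n = 1
  · subst hn1
    have hw : words 1 = {[1]} := by
      ext w
      rw [mem_words, Finset.mem_singleton]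
      constructor
      · intro h
        match w with
        | [] => simp [weight_nil] at h
        | i :: w =>
          rw [weight_cons] at h
          have hi := i.pos
          have h0 : w = [] := weight_eq_zero.mp (by omega)
          have h1 : i = 1 := PNat.coe_injective (by rw [PNat.one_coe]; omega)
          rw [h0, h1]
      · rintro rfl
        rfl
    have hP0 : P = 0 := by
      rw [action_apply, hw, Finset.sum_singleton] at hact
      have h1 : P [1] = 0 := by simpa [vectorFieldCoeff] using hact
      rw [hsum, hw, Finset.sum_singleton, h1, mul_zero, zero_div, zero_smul]
    rw [hP0]
    exact ⟨1, one_mem _, htriv⟩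
  have hn2 : 2 ≤ n := by omega
  have hl : P = ∑ w ∈ words n, (lastLetter w * P w / n) • lElem w := by
    have h : ∑ w ∈ words n, (lastLetter w * P w / n) • lElem w =
        P - (∑ w ∈ words n, lastLetter w * P w / n * gam w) • rElem n := by
      refine Eq.trans ?_ (congrArg (· - _) hsum.symm)
      rw [Finset.sum_smul, ← Finset.sum_sub_distrib]
      refine Finset.sum_congr rfl fun w hw => ?_
      rw [lElem, smul_sub, smul_smul, mem_words.mp hw]
    -- Each nested bracket sends `r` to `γ_w r ^ (n + 1)`, so this sum is the action of `P` on `r`.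
    -- Its vanishing allows every bracket to be replaced by the corresponding `l`.
    have h0 : ∑ w ∈ words n, lastLetter w * P w / n * gam w = 0 := by
      have hact' := congrArg (action 1 n) hsum
      rw [hact, map_sum] at hact'
      refine Eq.trans ?_ hact'.symm
      refine Finset.sum_congr rfl fun w hw => ?_
      have hw' := mem_words.mp hw
      have hw0 : w ≠ [] := by
        rintro rfl
        rw [weight_nil] at hw'
        omega
      have := action_nestedBracket w hw0 1
      rw [hw'] at this
      rw [map_smul, this, smul_eq_mul, Nat.cast_one, one_mul]
    rw [h, h0, zero_smul, sub_zero]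
  rw [hl]
  refine exists_mem_sum _ hn _ _ (fun w hw => ?_) fun w hw => ?_
  · have hw' := mem_words.mp hw
    have := isHomogeneous_lElem (w := w) (by omega)
    exact hw' ▸ this.smul _
  · have hw' := mem_words.mp hw
    by_cases hwA : ∀ i ∈ w, i = 1 ∨ i = 2
    · by_cases h5 : 5 ≤ weight w
      · refine ⟨_, Subgroup.subset_closure ⟨_, w, hwA, h5, rfl⟩, vanishesBelow_exp hn ?_⟩
        have := isHomogeneous_lElem (w := w) (by omega)
        exact hw' ▸ this.smul _
      · rw [lElem_eq_zero hwA (by omega) (by omega), smul_zero]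
        exact ⟨1, one_mem _, htriv⟩
    · have : P w = 0 := hsupp w (by
        push Not at hwA
        obtain ⟨i, hi, h1, h2⟩ := hwA
        exact ⟨i, hi, fun h => h.elim h1 h2⟩)
      rw [this, mul_zero, zero_div, zero_smul]
      exact ⟨1, one_mem _, htriv⟩

theorem closure_abelCenterGenerated :
    closure (abelCenterGenerated : Set SeriesGroup) =
      {g | g ∈ abelGroupLike ∧ firstReturn g = FormalGerm.id} := by
  refine Set.Subset.antisymm (closure_minimal abelCenterGenerated_subset ?_)
    subset_closure_abelCenterGenerated
  -- Triviality of the first return map is expressed by its coefficients, each continuous in `g`.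
  have h : IsClosed {g : SeriesGroup | ∀ n : ℕ+, action 1 n g.1 = FormalGerm.id.d n} := by
    simp only [Set.ofPred_forall]
    exact isClosed_iInter fun n => isClosed_eq
      ((continuous_action 1 n).comp continuous_subtype_val) continuous_const
  convert isClosed_abelGroupLike.inter h using 1
  ext g
  refine and_congr_right fun _ => ?_
  rw [← FormalGerm.d_injective.eq_iff, funext_iff]
  simp only [d_firstReturn]
  rfl

end CenterProblem

theorem proposition3p12 (T : ℝ) (hT : 0 < T) :
    (∃ T₂ : FormalGerm → formalPathsUpTo T 2, Continuous T₂ ∧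
      (∀ s : FormalGerm, firstReturn (T₂ s : SeriesGroup) = s) ∧
      ∃ Φ : (FormalGerm × abelFormalCenters T) ≃ₜ formalPathsUpTo T 2,
        ∀ (s : FormalGerm) (g : abelFormalCenters T),
          (Φ (s, g) : SeriesGroup) = (T₂ s : SeriesGroup) * (g : SeriesGroup)) ∧
    abelFormalCenters T = closure (abelCenterGenerated : Set SeriesGroup) := by
  have hG := formalPathsUpTo_two hT
  have hC := abelFormalCenters_eq hT
  have memG : ∀ g : SeriesGroup, g ∈ formalPathsUpTo T 2 ↔ g ∈ SeriesGroup.abelGroupLike :=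
    fun g => by rw [hG]; rfl
  have memC : ∀ g : SeriesGroup, g ∈ abelFormalCenters T ↔
      g ∈ SeriesGroup.abelGroupLike ∧ firstReturn g = FormalGerm.id := fun g => by rw [hC]; rfl
  refine ⟨⟨fun s => ⟨returnSection s, (memG _).mpr (returnSection_mem s)⟩,
    continuous_returnSection.subtype_mk _, firstReturn_returnSection,
    { toFun := fun p => ⟨returnSection p.1 * p.2.1,
        (memG _).mpr (mul_mem (returnSection_mem _) ((memC _).mp p.2.2).1)⟩
      -- A path and the section value at its first return map share that map, so their quotient is a
      -- center.
      invFun := fun x => (firstReturn x.1, ⟨(returnSection (firstReturn x.1))⁻¹ * x.1,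
        (memC _).mpr ⟨mul_mem (inv_mem (returnSection_mem _)) ((memG _).mp x.2),
          firstReturn_inv_mul (returnSection_mem _) ((memG _).mp x.2)
            (firstReturn_returnSection _)⟩⟩)
      left_inv := ?_
      right_inv := ?_
      continuous_toFun := ?_
      continuous_invFun := ?_ }, fun s g => rfl⟩, hC.trans closure_abelCenterGenerated.symm⟩
  · rintro ⟨s, g⟩
    have hg := (memC _).mp g.2
    have e : firstReturn (returnSection s * g.1) = s :=
      (firstReturn_mul hg.1 hg.2).trans (firstReturn_returnSection s)
    refine Prod.ext e (Subtype.ext ?_)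
    change (returnSection (firstReturn (returnSection s * g.1)))⁻¹ * (returnSection s * g.1) = g.1
    rw [e, inv_mul_cancel_left]
  · intro x
    exact Subtype.ext (mul_inv_cancel_left _ _)
  · exact (SeriesGroup.continuous_mul_group (continuous_returnSection.comp continuous_fst)
      (continuous_subtype_val.comp continuous_snd)).subtype_mk _
  · have h := continuous_firstReturn.comp
      (continuous_subtype_val (p := fun g => g ∈ formalPathsUpTo T 2))
    exact h.prodMk ((SeriesGroup.continuous_mul_group
      (SeriesGroup.continuous_inv_group.comp (continuous_returnSection.comp h))
      continuous_subtype_val).subtype_mk _)
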